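/- Identify $\mathcal P(A)$ with $\{0,1\}^A$ with its product topology. An \emph{ideal} on a set $A$ is a nonempty family of subsets of $A$ closed under finite unions and under taking subsets. A \emph{lower semicontinuous submeasure} on $\mathbb N$ is a map $\varphi:\mathcal P(\mathbb N)\to[0,\infty]$ with $\varphi(\emptyset)=0$, $\varphi(\{n\})<\infty$ for all $n$, $\varphi(x)\le\varphi(x\cup y)\le\varphi(x)+\varphi(y)$ and $\varphi(x)=\sup_n\varphi(x\cap[0,n))$ for all $x,y\subseteq\mathbb N$; put $\mathrm{Exh}_\varphi=\{x\subseteq\mathbb N:\inf_n\varphi(x\cap[n,\infty))=0\}$. Let $\mathcal I_1$ be the ideal on $\mathbb N\times\mathbb N$ of all $x$ such that $\{l:(k,l)\in x\}\neq\emptyset$ for only finitely many $k$. \textbf{Theorem (Solecki).} Let $\mathcal I$ be an ideal on $\mathbb N$ containing all singletons. The following are equivalent: (i) $\mathcal I=\mathrm{Exh}_\varphi$ for some lower semicontinuous submeasure $\varphi$ on $\mathbb N$; (ii) $\mathcal I$ is polishable, i.e. there is a Polish group topology on $(\mathcal I,\triangle)$ ($\triangle$ is symmetric difference) which has the same Borel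 sets as the topology inherited from $\mathcal P(\mathbb N)$; (iii) $\mathcal I$ is an analytic subset of $\mathcal P(\mathbb N)$ and a P-ideal, i.e. for any sequence $x_n\in\mathcal I$ there is $x\in\mathcal I$ such that $x_n\setminus x$ is finite for all $n$; (iv) $\mathcal I$ is analytic and $\mathcal I_1\not\le_{RB}\mathcal I$, i.e. there is no finite-to-one map $b:\mathbb N\to\mathbb N\times\mathbb N$ such that $x\in\mathcal I_1\Leftrightarrow b^{-1}(x)\in\mathcal I$ for all $x\subseteq\mathbb N\times\mathbb N$; (v) $\mathcal I$ is analytic and every countable union of $\mathcal I$-small sets is $\mathcal I$-small, where $X\subseteq\mathcal P(\mathbb N)$ is $\mathcal I$-small if there is $A\in\mathcal I$ such that $\{x\cap A:x\in X\}$ is meager in $\mathcal P(A)$. Moreover, if $\mathcal I$ is an analytic P-ideal, then $\mathcal I$ is a $\mathbf\Pi^0_3$ subset of $\mathcal P(\mathbb N)$. -/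

import Mathlib

open Set
open scoped ENNReal symmDiff

/-- The usual compact topology on the power set of `α`: the product topology of `{0,1}^α`,
carried over to subsets through their indicator functions. -/
noncomputable abbrev powersetTopology (α : Type*) : TopologicalSpace (Set α) :=
  TopologicalSpace.induced (fun (x : Set α) (a : α) => (open Classical in decide (a ∈ x)))
    (Pi.topologicalSpace : TopologicalSpace (α → Bool))

/-- A lower semicontinuous submeasure on `ℕ`, with values in `[0, ∞]`. -/
structure LscSubmeasure where
  toFun : Set ℕ → ℝ≥0∞
  map_empty : toFun ∅ = 0
  map_singleton_lt_top : ∀ n, toFun {n} < ∞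
  le_map_union : ∀ x y, toFun x ≤ toFun (x ∪ y)
  map_union_le : ∀ x y, toFun (x ∪ y) ≤ toFun x + toFun y
  lsc : ∀ x, toFun x = ⨆ n : ℕ, toFun (x ∩ Iio n)

namespace LscSubmeasure

theorem mono (φ : LscSubmeasure) {x y : Set ℕ} (h : x ⊆ y) : φ.toFun x ≤ φ.toFun y := by
  have := φ.le_map_union x y
  rwa [union_eq_self_of_subset_left h] at this

/-- The tail submeasure `x ↦ inf_n φ (x ∩ [n, ∞))`. -/
noncomputable def tail (φ : LscSubmeasure) (x : Set ℕ) : ℝ≥0∞ :=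
  ⨅ n : ℕ, φ.toFun (x ∩ Ici n)

theorem tail_mono (φ : LscSubmeasure) {x y : Set ℕ} (h : x ⊆ y) : φ.tail x ≤ φ.tail y :=
  iInf_mono fun _ => φ.mono (inter_subset_inter_left _ h)

theorem tail_union_le (φ : LscSubmeasure) (x y : Set ℕ) :
    φ.tail (x ∪ y) ≤ φ.tail x + φ.tail y := by
  unfold tail
  refine ENNReal.le_iInf_add_iInf (f := fun n => φ.toFun (x ∩ Ici n))
    (g := fun n => φ.toFun (y ∩ Ici n)) fun i j => ?_
  refine (iInf_le _ (max i j)).trans ?_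
  rw [union_inter_distrib_right]
  refine (φ.map_union_le _ _).trans (add_le_add (φ.mono ?_) (φ.mono ?_))
  · exact inter_subset_inter_right _ (Ici_subset_Ici.2 (le_max_left i j))
  · exact inter_subset_inter_right _ (Ici_subset_Ici.2 (le_max_right i j))

/-- The exhaustive ideal `Exh_φ` of all `x` whose tail submeasure is zero. -/
def exh (φ : LscSubmeasure) : Order.Ideal (Set ℕ) where
  carrier := {x | φ.tail x = 0}
  lower' _ _ hyx hx := le_antisymm ((φ.tail_mono hyx).trans (le_of_eq hx)) zero_le
  nonempty' := ⟨∅, le_antisymm ((iInf_le _ 0).trans (by simp [φ.map_empty])) zero_le⟩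
  directed' x hx y hy := by
    refine ⟨x ∪ y, ?_, subset_union_left, subset_union_right⟩
    refine le_antisymm ((φ.tail_union_le x y).trans ?_) zero_le
    rw [show φ.tail x = 0 from hx, show φ.tail y = 0 from hy, add_zero]

/-- `Exh_φ` always contains all singletons. -/
theorem singleton_mem_exh (φ : LscSubmeasure) (n : ℕ) : {n} ∈ φ.exh := by
  refine le_antisymm ((iInf_le _ (n + 1)).trans ?_) zero_le
  have : ({n} : Set ℕ) ∩ Ici (n + 1) = ∅ := by ext k; simp
  rw [this, φ.map_empty]

end LscSubmeasure

/-- An ideal is a group under symmetric difference. -/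
theorem symmDiff_mem_ideal {α : Type*} (I : Order.Ideal (Set α)) {x y : Set α}
    (hx : x ∈ I) (hy : y ∈ I) : x ∆ y ∈ I :=
  I.lower (symmDiff_le_sup : x ∆ y ≤ x ⊔ y) (Order.Ideal.sup_mem hx hy)

/-- The topology on the ideal `I` inherited from the power set of `ℕ`. -/
noncomputable abbrev inheritedTopology (I : Order.Ideal (Set ℕ)) : TopologicalSpace {x : Set ℕ // x ∈ I} :=
  TopologicalSpace.induced Subtype.val (powersetTopology ℕ)

/-- `I` is polishable: there is a Polish group topology `τ` on `(I, ∆)` with the same Borel sets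
as the inherited topology. In `(I, ∆)` every element is its own inverse, so a topology is a group
topology if and only if `∆` is jointly continuous. -/
def IsPolishableIdeal (I : Order.Ideal (Set ℕ)) : Prop :=
  ∃ τ : TopologicalSpace {x : Set ℕ // x ∈ I},
    @PolishSpace _ τ ∧
    @Continuous _ _ (@instTopologicalSpaceProd _ _ τ τ) τ
      (fun p : {x : Set ℕ // x ∈ I} × {x : Set ℕ // x ∈ I} =>
        (⟨p.1.1 ∆ p.2.1, symmDiff_mem_ideal I p.1.2 p.2.2⟩ : {x : Set ℕ // x ∈ I})) ∧
    @borel _ τ = @borel _ (inheritedTopology I)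

/-- `I` is an analytic (`Σ¹₁`) subset of the power set of `ℕ`. -/
def IsAnalyticIdeal (I : Order.Ideal (Set ℕ)) : Prop :=
  @MeasureTheory.AnalyticSet (Set ℕ) (powersetTopology ℕ) (I : Set (Set ℕ))

/-- P-ideals: every sequence in `I` has a pseudo-union in `I`. -/
def IsPIdeal (I : Order.Ideal (Set ℕ)) : Prop :=
  ∀ x : ℕ → Set ℕ, (∀ n, x n ∈ I) → ∃ y ∈ I, ∀ n, (x n \ y).Finite

/-- The ideal `I₁ = Fin × 0` on `ℕ × ℕ`, of all `x` with only finitely many nonempty vertical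
sections `{l | (k, l) ∈ x}`. -/
def idealOne : Order.Ideal (Set (ℕ × ℕ)) where
  carrier := {x | {k : ℕ | {l : ℕ | (k, l) ∈ x}.Nonempty}.Finite}
  lower' _ _ hyx hx := hx.subset fun _ ⟨l, hl⟩ => ⟨l, hyx hl⟩
  nonempty' := ⟨∅, by simp⟩
  directed' x hx y hy := by
    refine ⟨x ∪ y, ?_, subset_union_left, subset_union_right⟩
    refine (Finite.union hx hy).subset ?_
    rintro k ⟨l, hl | hl⟩
    · exact Or.inl ⟨l, hl⟩
    · exact Or.inr ⟨l, hl⟩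

/-- The Rudin-Blass order between ideals on `α` and `β`: a finite-to-one map `b : β → α` with
`x ∈ I ↔ b⁻¹ x ∈ J`. -/
def RudinBlassLE {α β : Type*} (I : Order.Ideal (Set α)) (J : Order.Ideal (Set β)) : Prop :=
  ∃ b : β → α, (∀ a, (b ⁻¹' {a}).Finite) ∧ ∀ x : Set α, x ∈ I ↔ b ⁻¹' x ∈ J

/-- The restriction `{x ∩ A | x ∈ X}`, as a family of subsets of the subtype `A`. -/
def restrictFamily (X : Set (Set ℕ)) (A : Set ℕ) : Set (Set A) :=
  (fun x : Set ℕ => (Subtype.val ⁻¹' x : Set A)) '' X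

/-- `X` is `I`-small: for some `A ∈ I`, the restriction of `X` to `A` is meager in the power set
of `A`. -/
def IsSmallFor (I : Order.Ideal (Set ℕ)) (X : Set (Set ℕ)) : Prop :=
  ∃ A ∈ I, @IsMeagre (Set A) (powersetTopology A) (restrictFamily X A)

/-- `Π⁰₃` subsets of the power set of `ℕ`: countable intersections of countable unions of
closed sets. -/
def IsPiZeroThree (S : Set (Set ℕ)) : Prop :=
  ∃ F : ℕ → ℕ → Set (Set ℕ), (∀ n m, @IsClosed (Set ℕ) (powersetTopology ℕ) (F n m)) ∧
    S = ⋂ n, ⋃ m, F n m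

/-! The proof runs through the cycle (i) → (ii) → (iii) → (v) → (iv) → (i).

For (i) → (ii), `φ (x ∆ y)` is a complete separable metric on `Exh_φ` once `φ` is made positive on
singletons. For (ii) → (iii), Pettis' theorem makes the Borel homomorphisms `I → P(ℕ)` and `y ↦ y ∩
x n` continuous. Hence adding a far tail of `x n` moves a point of `I` very little, and a limit of
such additions is a pseudo-union. (iii) → (v) → (iv) is Baire category on the power sets `P(A)`.

The core is (iv) → (i). Call a family dominating if the closed hereditary family it generates
contains a tail of each element of `I`. If `I` were a countable union of non-dominating families,
the witnesses could be glued into a reduction of `I₁` to `I` (`rudinBlassLE_of_cover`). So `I` is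
large, and in a parametrization `f` of `I` by Baire space one may keep only points whose
neighbourhoods all have large image. The hulls of these images are absorbing. Fusion arguments
building two branches `α`, `β` and using `f α ∪ f β ∈ I` show that these countably many hulls
determine `I` (`mem_of_forall_family`) and that every absorbing family can be halved
(`exists_half`). Iterated halving gives a chain of families, and a Frink-style metrization argument
turns the chain into a submeasure (`exists_eq_exh_of_absorbing`).

The `Π⁰₃` bound is read off the definition of `Exh_φ`. -/

/-- A closed hereditary family of sets which contains a tail of every element of `I`. -/
structure IsAbsorbing (I : Order.Ideal (Set ℕ)) (K : Set (Set ℕ)) : Prop where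
  hereditary : ∀ ⦃x y : Set ℕ⦄, x ⊆ y → y ∈ K → x ∈ K
  closed : ∀ ⦃x : Set ℕ⦄, (∀ m, x ∩ Iio m ∈ K) → x ∈ K
  absorb : ∀ ⦃x⦄, x ∈ I → ∃ n, x ∩ Ici n ∈ K

theorem isAbsorbing_univ (I : Order.Ideal (Set ℕ)) : IsAbsorbing I univ :=
  ⟨fun _ _ _ _ => mem_univ _, fun _ _ => mem_univ _, fun _ _ => ⟨0, mem_univ _⟩⟩

theorem IsAbsorbing.inter {I : Order.Ideal (Set ℕ)} {K L : Set (Set ℕ)}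
    (hK : IsAbsorbing I K) (hL : IsAbsorbing I L) : IsAbsorbing I (K ∩ L) where
  hereditary _ _ h hy := ⟨hK.hereditary h hy.1, hL.hereditary h hy.2⟩
  closed _ h := ⟨hK.closed fun m => (h m).1, hL.closed fun m => (h m).2⟩
  absorb x hx := by
    obtain ⟨n, hn⟩ := hK.absorb hx
    obtain ⟨m, hm⟩ := hL.absorb hx
    refine ⟨max n m, hK.hereditary ?_ hn, hL.hereditary ?_ hm⟩
    · exact inter_subset_inter_right _ (Ici_subset_Ici.2 (le_max_left _ _))
    · exact inter_subset_inter_right _ (Ici_subset_Ici.2 (le_max_right _ _))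

/-! ### The submeasure of a chain of hereditary families -/

/-- The cut is at the element where the partial sums first reach `c`. With `c` half of a bound on
the total, both sides of the cut weigh less than `c`. -/
theorem List.exists_split_sum {α : Type*} (w : α → ℝ≥0∞) (c : ℝ≥0∞) :
    ∀ l : List α, 0 < c → c ≤ (l.map w).sum →
      ∃ l₁ a l₂, l = l₁ ++ a :: l₂ ∧ (l₁.map w).sum < c ∧ c ≤ (l₁.map w).sum + w a := by
  intro l
  induction l using List.reverseRecOn with
  | nil => intro h h'; simp at h'; simp [h'] at h
  | append_singleton l a ih =>
    intro hc h
    by_cases hl : c ≤ (l.map w).sum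
    · obtain ⟨l₁, b, l₂, rfl, h1, h2⟩ := ih hc hl
      exact ⟨l₁, b, l₂ ++ [a], by simp, h1, h2⟩
    · exact ⟨l, a, [], rfl, not_le.1 hl, by simpa using h⟩

/-- The weight `2⁻ⁿ`, for the last `n` with `x ∈ C n`. -/
noncomputable def chainWeight (C : ℕ → Set (Set ℕ)) (x : Set ℕ) : ℝ≥0∞ :=
  ⨅ (n : ℕ) (_ : x ∈ C n), (2⁻¹ : ℝ≥0∞) ^ n

/-- The union of a list of sets. -/
def listUnion (l : List (Set ℕ)) : Set ℕ := {k | ∃ a ∈ l, k ∈ a}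

theorem listUnion_append (l l' : List (Set ℕ)) :
    listUnion (l ++ l') = listUnion l ∪ listUnion l' := by
  ext k; simp [listUnion, or_and_right, exists_or]

theorem listUnion_cons (a : Set ℕ) (l : List (Set ℕ)) :
    listUnion (a :: l) = a ∪ listUnion l := by
  ext k; simp [listUnion]

/-- The largest subadditive function below `chainWeight`. -/
noncomputable def chainOuter (C : ℕ → Set (Set ℕ)) (x : Set ℕ) : ℝ≥0∞ :=
  ⨅ (l : List (Set ℕ)) (_ : x ⊆ listUnion l), (l.map (chainWeight C)).sum

/-- A decreasing chain of hereditary families whose triple unions go one step up. -/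
structure IsTripleChain (C : ℕ → Set (Set ℕ)) : Prop where
  zero : C 0 = univ
  empty_mem : ∀ n, ∅ ∈ C n
  hereditary : ∀ ⦃n x y⦄, x ⊆ y → y ∈ C n → x ∈ C n
  closed : ∀ ⦃n x⦄, (∀ m, x ∩ Iio m ∈ C n) → x ∈ C n
  triple : ∀ ⦃n x y z⦄, x ∈ C (n + 1) → y ∈ C (n + 1) → z ∈ C (n + 1) → x ∪ y ∪ z ∈ C n

namespace IsTripleChain

variable {C : ℕ → Set (Set ℕ)} (hC : IsTripleChain C)
include hC

theorem anti : Antitone C := by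
  refine antitone_nat_of_succ_le fun n x hx => ?_
  have := hC.triple hx hx hx
  simpa using this

/-- The strict inequality gains a level: the weight is an infimum of powers of `1/2`, so some
exponent exceeds `n`. -/
theorem mem_of_weight_lt {n : ℕ} {x : Set ℕ} (h : chainWeight C x < 2⁻¹ ^ n) : x ∈ C (n + 1) := by
  simp only [chainWeight, iInf_lt_iff] at h
  obtain ⟨m, hm, h⟩ := h
  refine hC.anti ?_ hm
  by_contra hlt
  exact absurd h (not_lt.2 (pow_le_pow_right_of_le_one' (by simp) (by omega)))

omit hC in
theorem weight_le {n : ℕ} {x : Set ℕ} (h : x ∈ C n) : chainWeight C x ≤ 2⁻¹ ^ n :=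
  iInf₂_le n h

/-- Frink's argument, by induction on the length: cut the list at half of the bound `2⁻ⁿ`. The two
sides lie in `C (n + 1)` by induction and the middle set by its weight; `triple` joins the three. -/
theorem listUnion_mem : ∀ (k : ℕ) (l : List (Set ℕ)), l.length ≤ k → ∀ n,
    (l.map (chainWeight C)).sum < 2⁻¹ ^ n → listUnion l ∈ C n := by
  have half : ∀ n : ℕ, (2⁻¹ : ℝ≥0∞) ^ n = 2⁻¹ ^ (n + 1) + 2⁻¹ ^ (n + 1) := fun n => by
    rw [pow_succ, ← mul_add, ENNReal.inv_two_add_inv_two, mul_one]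
  intro k
  induction k with
  | zero =>
    intro l hl n _
    obtain rfl : l = [] := by simpa using hl
    have : listUnion [] = ∅ := by ext; simp [listUnion]
    rw [this]; exact hC.empty_mem n
  | succ k ih =>
    intro l hl n hs
    by_cases hlt : 2⁻¹ ^ (n + 1) ≤ (l.map (chainWeight C)).sum
    · obtain ⟨l₁, a, l₂, rfl, h1, h2⟩ :=
        List.exists_split_sum _ _ _ (ENNReal.pow_pos (by simp) _) hlt
      simp only [List.map_append, List.map_cons, List.sum_append, List.sum_cons] at hs
      simp only [List.length_append, List.length_cons] at hl
      have h3 : (l₂.map (chainWeight C)).sum < 2⁻¹ ^ (n + 1) := by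
        by_contra hge
        refine absurd hs (not_lt.2 ?_)
        rw [half, ← add_assoc]
        exact add_le_add h2 (not_lt.1 hge)
      have h4 : a ∈ C (n + 1) := hC.mem_of_weight_lt
        (lt_of_le_of_lt (le_trans (by rw [add_left_comm]; exact le_self_add) le_rfl) hs)
      have := hC.triple (ih l₁ (by omega) _ h1) h4 (ih l₂ (by omega) _ h3)
      rwa [listUnion_append, listUnion_cons, ← union_assoc]
    -- Below half of the bound no cut is needed: the head is split off and used twice in `triple`.
    · cases l with
      | nil => exact ih [] (by simp) n hs
      | cons a l =>
        simp only [List.map_cons, List.sum_cons] at hs hlt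
        simp only [List.length_cons] at hl
        have h4 : a ∈ C (n + 1) := hC.mem_of_weight_lt (lt_of_le_of_lt le_self_add hs)
        have h5 := ih l (by omega) (n + 1) (lt_of_le_of_lt le_add_self (not_le.1 hlt))
        rw [listUnion_cons]
        simpa using hC.triple h4 h4 h5

omit hC in
theorem outer_mono {x y : Set ℕ} (h : x ⊆ y) : chainOuter C x ≤ chainOuter C y :=
  le_iInf₂ fun l hl => iInf₂_le l (h.trans hl)

omit hC in
theorem outer_union_le (x y : Set ℕ) : chainOuter C (x ∪ y) ≤ chainOuter C x + chainOuter C y := by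
  refine ENNReal.le_of_forall_pos_le_add fun ε hε hfin => ?_
  have hx : chainOuter C x < chainOuter C x + (ε / 2 : NNReal) :=
    ENNReal.lt_add_right (ne_top_of_le_ne_top hfin.ne le_self_add) (by simpa using hε.ne')
  have hy : chainOuter C y < chainOuter C y + (ε / 2 : NNReal) :=
    ENNReal.lt_add_right (ne_top_of_le_ne_top hfin.ne le_add_self) (by simpa using hε.ne')
  obtain ⟨l, hl⟩ := iInf_lt_iff.1 hx
  obtain ⟨hxl, hl⟩ := iInf_lt_iff.1 hl
  obtain ⟨l', hl'⟩ := iInf_lt_iff.1 hy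
  obtain ⟨hyl, hl'⟩ := iInf_lt_iff.1 hl'
  refine (iInf₂_le (l ++ l') ?_).trans ?_
  · rw [listUnion_append]; exact union_subset_union hxl hyl
  · rw [List.map_append, List.sum_append]
    refine (add_le_add hl.le hl'.le).trans (le_of_eq ?_)
    rw [add_add_add_comm, ← ENNReal.coe_add, add_halves]

omit hC in
theorem outer_le_weight (x : Set ℕ) : chainOuter C x ≤ chainWeight C x :=
  (iInf₂_le [x] (fun k hk => ⟨x, by simp, hk⟩)).trans (by simp)

omit hC in
theorem outer_empty : chainOuter C ∅ = 0 :=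
  le_antisymm ((iInf₂_le [] (empty_subset _)).trans (by simp)) zero_le

theorem mem_of_outer_lt {n : ℕ} {x : Set ℕ} (h : chainOuter C x < 2⁻¹ ^ n) : x ∈ C n := by
  simp only [chainOuter, iInf_lt_iff] at h
  obtain ⟨l, hl, h⟩ := h
  exact hC.hereditary hl (hC.listUnion_mem _ l le_rfl n h)

/-- The lower semicontinuous submeasure of a chain. -/
noncomputable def submeasure : LscSubmeasure where
  toFun x := ⨆ n : ℕ, chainOuter C (x ∩ Iio n)
  map_empty := by simp [outer_empty]
  map_singleton_lt_top n := by
    refine lt_of_le_of_lt (iSup_le fun m => ?_) ENNReal.one_lt_top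
    refine (outer_le_weight _).trans ((weight_le (n := 0) ?_).trans (by simp))
    rw [hC.zero]; exact mem_univ _
  le_map_union x y := iSup_mono fun n => outer_mono (inter_subset_inter_left _ subset_union_left)
  map_union_le x y := iSup_le fun n => by
    rw [union_inter_distrib_right]
    exact (outer_union_le _ _).trans (add_le_add
      (le_iSup (fun n => chainOuter C (x ∩ Iio n)) n) (le_iSup (fun n => chainOuter C (y ∩ Iio n)) n))
  lsc x := by
    refine le_antisymm (iSup_mono fun n => ?_) (iSup_le fun n => iSup_mono fun m => ?_)
    · refine le_iSup_of_le n (outer_mono ?_)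
      rw [inter_assoc, inter_self]
    · exact outer_mono (inter_subset_inter_left _ inter_subset_left)

theorem mem_of_submeasure_lt {n : ℕ} {x : Set ℕ} (h : hC.submeasure.toFun x < 2⁻¹ ^ n) :
    x ∈ C n :=
  hC.closed fun m => hC.mem_of_outer_lt
    (lt_of_le_of_lt (le_iSup (fun n => chainOuter C (x ∩ Iio n)) m) h)

theorem submeasure_le {n : ℕ} {x : Set ℕ} (h : x ∈ C n) : hC.submeasure.toFun x ≤ 2⁻¹ ^ n :=
  iSup_le fun _ => (outer_le_weight _).trans (weight_le (hC.hereditary inter_subset_left h))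

theorem mem_exh_iff {x : Set ℕ} : x ∈ hC.submeasure.exh ↔ ∀ n, ∃ m, x ∩ Ici m ∈ C n := by
  change hC.submeasure.tail x = 0 ↔ _
  constructor
  · intro h n
    have : hC.submeasure.tail x < 2⁻¹ ^ n := by rw [h]; exact ENNReal.pow_pos (by simp) _
    obtain ⟨m, hm⟩ := iInf_lt_iff.1 this
    exact ⟨m, hC.mem_of_submeasure_lt hm⟩
  · intro h
    refine le_antisymm (ENNReal.le_of_forall_pos_le_add fun ε hε _ => ?_) zero_le
    obtain ⟨n, hn⟩ := ENNReal.exists_inv_two_pow_lt (ENNReal.coe_ne_zero.2 hε.ne')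
    obtain ⟨m, hm⟩ := h n
    rw [zero_add]
    exact (iInf_le _ m).trans ((hC.submeasure_le hm).trans hn.le)

end IsTripleChain

/-- An ideal which is the intersection of the families absorbed by countably many absorbing ones
is exhaustive, as soon as absorbing families can be halved. -/
theorem exists_eq_exh_of_absorbing (I : Order.Ideal (Set ℕ)) (K : ℕ → Set (Set ℕ))
    (hK : ∀ n, IsAbsorbing I (K n)) (hI : ∀ x, (∀ n, ∃ m, x ∩ Ici m ∈ K n) → x ∈ I)
    (half : ∀ L, IsAbsorbing I L → ∃ L', IsAbsorbing I L' ∧ ∀ x ∈ L', ∀ y ∈ L', x ∪ y ∈ L) :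
    ∃ φ : LscSubmeasure, I = φ.exh := by
  have third : ∀ L : {L // IsAbsorbing I L}, ∀ n, ∃ L' : {L // IsAbsorbing I L},
      (∀ x ∈ L'.1, ∀ y ∈ L'.1, ∀ z ∈ L'.1, x ∪ y ∪ z ∈ L.1) ∧ L'.1 ⊆ K n := by
    rintro ⟨L, hL⟩ n
    obtain ⟨L₁, h₁, h₁'⟩ := half L hL
    obtain ⟨L₂, h₂, h₂'⟩ := half L₁ h₁
    -- Halving twice handles four sets, hence three; intersecting with `K n` makes the chain refine
    -- every given family.
    refine ⟨⟨L₂ ∩ K n, h₂.inter (hK n)⟩, fun x hx y hy z hz => ?_, inter_subset_right⟩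
    refine h₁' _ (h₂' x hx.1 y hy.1) z ?_
    simpa using h₂' z hz.1 z hz.1
  choose g hg hgK using third
  let D : ℕ → {L // IsAbsorbing I L} := fun n =>
    Nat.rec ⟨univ, isAbsorbing_univ I⟩ (fun n L => g L n) n
  have hC : IsTripleChain fun n => (D n).1 :=
    { zero := rfl
      empty_mem := fun n => by
        obtain ⟨m, hm⟩ := (D n).2.absorb I.bot_mem
        exact (D n).2.hereditary (empty_subset _) hm
      hereditary := fun n _ _ h hy => (D n).2.hereditary h hy
      closed := fun n _ h => (D n).2.closed h
      triple := fun n x y z hx hy hz => hg (D n) n x hx y hy z hz }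
  refine ⟨hC.submeasure, ?_⟩
  ext x
  change x ∈ I ↔ x ∈ hC.submeasure.exh
  rw [hC.mem_exh_iff]
  refine ⟨fun hx n => (D n).2.absorb hx, fun h => hI x fun n => ?_⟩
  obtain ⟨m, hm⟩ := h (n + 1)
  exact ⟨m, hgK (D n) n hm⟩

/-! ### Dominating families and the Rudin-Blass reduction -/

theorem ideal_union_mem {α : Type*} (I : Order.Ideal (Set α)) {x y : Set α} (hx : x ∈ I)
    (hy : y ∈ I) : x ∪ y ∈ I :=
  Order.Ideal.sup_mem hx hy

theorem ideal_subset_mem {α : Type*} (I : Order.Ideal (Set α)) {x y : Set α} (h : x ⊆ y)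
    (hy : y ∈ I) : x ∈ I :=
  I.lower h hy

theorem ideal_biUnion_mem {α ι : Type*} (I : Order.Ideal (Set α)) {B : ι → Set α}
    (hB : ∀ i, B i ∈ I) {F : Set ι} (hF : F.Finite) : ⋃ i ∈ F, B i ∈ I := by
  induction F, hF using Set.Finite.induction_on with
  | empty => simpa using I.bot_mem
  | @insert a s _ _ ih =>
    rw [biUnion_insert]
    exact ideal_union_mem I (hB a) ih

theorem ideal_finite_mem {α : Type*} (I : Order.Ideal (Set α)) (hI : ∀ n : α, {n} ∈ I)
    {F : Set α} (hF : F.Finite) : F ∈ I := by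
  simpa using ideal_biUnion_mem I hI hF

/-- The sets all of whose finite initial parts are covered by an element of `X`. -/
def closedHull (X : Set (Set ℕ)) : Set (Set ℕ) :=
  {x | ∀ m, ∃ y ∈ X, x ∩ Iio m ⊆ y}

theorem closedHull_hereditary {X : Set (Set ℕ)} ⦃x y : Set ℕ⦄ (h : x ⊆ y)
    (hy : y ∈ closedHull X) : x ∈ closedHull X := fun m => by
  obtain ⟨z, hz, h'⟩ := hy m
  exact ⟨z, hz, (inter_subset_inter_left _ h).trans h'⟩

theorem closedHull_closed {X : Set (Set ℕ)} ⦃x : Set ℕ⦄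
    (h : ∀ m, x ∩ Iio m ∈ closedHull X) : x ∈ closedHull X := fun m => by
  obtain ⟨z, hz, h'⟩ := h m m
  exact ⟨z, hz, by rwa [inter_assoc, inter_self] at h'⟩

theorem closedHull_mono {X Y : Set (Set ℕ)} (h : X ⊆ Y) : closedHull X ⊆ closedHull Y :=
  fun _ hx m => (hx m).imp fun _ hz => ⟨h hz.1, hz.2⟩

/-- `X` is dominating if its closed hull contains a tail of every element of `I`. -/
def IsDominating (I : Order.Ideal (Set ℕ)) (X : Set (Set ℕ)) : Prop :=
  ∀ x ∈ I, ∃ n, x ∩ Ici n ∈ closedHull X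

theorem IsDominating.mono {I : Order.Ideal (Set ℕ)} {X Y : Set (Set ℕ)} (h : X ⊆ Y)
    (hX : IsDominating I X) : IsDominating I Y := fun x hx =>
  (hX x hx).imp fun _ hn => closedHull_mono h hn

theorem IsDominating.isAbsorbing {I : Order.Ideal (Set ℕ)} {X : Set (Set ℕ)}
    (hX : IsDominating I X) : IsAbsorbing I (closedHull X) :=
  ⟨closedHull_hereditary, closedHull_closed, fun x hx => hX x hx⟩

/-- An ideal covered by countably many non-dominating families is Rudin-Blass above `I₁`. -/
theorem rudinBlassLE_of_cover (I : Order.Ideal (Set ℕ)) (hI : ∀ n : ℕ, {n} ∈ I)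
    (X : ℕ → Set (Set ℕ)) (hcov : ∀ x ∈ I, ∃ n, x ∈ X n) (hX : ∀ n, ¬ IsDominating I (X n)) :
    RudinBlassLE idealOne I := by
  simp only [IsDominating, closedHull, mem_ofPred_eq] at hX
  push Not at hX
  choose A hA q hq using hX
  -- No member of `X n` contains `A n ∩ [r, q n r)`. The blocks `[p i, p (i + 1))` are long enough
  -- to include `[p i, q n (p i))` for every `n ≤ i`.
  let p : ℕ → ℕ := fun i =>
    Nat.rec 0 (fun i r => max (r + 1) ((Finset.range (i + 1)).sup fun n => q n r)) i
  have p_succ : ∀ i, p (i + 1) = max (p i + 1) ((Finset.range (i + 1)).sup fun n => q n (p i)) :=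
    fun i => rfl
  have p_mono : StrictMono p := strictMono_nat_of_lt_succ fun i => by
    rw [p_succ]; exact lt_of_lt_of_le (Nat.lt_succ_self _) (le_max_left _ _)
  have q_le : ∀ i n, n ≤ i → q n (p i) ≤ p (i + 1) := fun i n h => by
    rw [p_succ]
    exact le_max_of_le_right
      (Finset.le_sup (f := fun n => q n (p i)) (Finset.mem_range.2 (Nat.lt_succ_of_le h)))
  have exists_block : ∀ j, ∃ i, p i ≤ j ∧ j < p (i + 1) := by
    intro j
    have hex : ∃ i, j < p (i + 1) := ⟨j, lt_of_lt_of_le (Nat.lt_succ_self j) p_mono.le_apply⟩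
    classical
    refine ⟨Nat.find hex, ?_, Nat.find_spec hex⟩
    rcases h : Nat.find hex with _ | i
    · exact Nat.zero_le _
    · exact not_lt.1 (Nat.find_min hex (m := i) (by omega))
  choose blk hblk hblk' using exists_block
  have blk_eq : ∀ i j, p i ≤ j → j < p (i + 1) → blk j = i := fun i j h1 h2 => by
    have a : i < blk j + 1 := p_mono.lt_iff_lt.1 (lt_of_le_of_lt h1 (hblk' j))
    have b : blk j < i + 1 := p_mono.lt_iff_lt.1 (lt_of_le_of_lt (hblk j) h2)
    omega
  let B : ℕ → Set ℕ := fun k => ⋃ n ∈ Iic k, A n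
  have hB : ∀ k, B k ∈ I := fun k => ideal_biUnion_mem I hA (finite_Iic k)
  classical
  -- Block `pair k l` is sent to `(k, l)` on `B k`. Other points `j` go to `(j, 0)`, which adds at
  -- most the point `j` to the preimage of column `j`.
  let b : ℕ → ℕ × ℕ := fun j =>
    if j ∈ B (Nat.unpair (blk j)).1 then Nat.unpair (blk j) else (j, 0)
  have b_fst : ∀ j, j ∈ B (b j).1 ∪ {(b j).1} := fun j => by
    by_cases h : j ∈ B (Nat.unpair (blk j)).1 <;> simp [b, h]
  refine ⟨b, fun a => ?_, fun x => ⟨fun hx => ?_, fun hx => ?_⟩⟩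
  · refine ((finite_Iio (p (Nat.pair a.1 a.2 + 1))).union (finite_singleton a.1)).subset ?_
    rintro j rfl
    by_cases h : j ∈ B (Nat.unpair (blk j)).1
    · left
      simp only [b, h, if_true, Nat.pair_unpair]
      exact hblk' j
    · right; simp [b, h]
  · refine ideal_subset_mem I ?_
      (ideal_biUnion_mem I (fun k => ideal_union_mem I (hB k) (hI k)) hx)
    intro j hj
    exact mem_biUnion (x := (b j).1) ⟨(b j).2, hj⟩ (b_fst j)
  · by_contra hinf
    obtain ⟨n, hn⟩ := hcov _ hx
    obtain ⟨k, ⟨l, hl⟩, hk⟩ := Set.Infinite.exists_gt (show Set.Infinite _ from hinf) n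
    set i := Nat.pair k l
    have hki : k ≤ i := Nat.left_le_pair k l
    -- As `n < k ≤ i`, the part of `A n` in `[p i, q n (p i))` lies in `B k` and in block `i`, so it
    -- is mapped to `(k, l) ∈ x`. This contradicts `b ⁻¹' x ∈ X n`.
    refine hq n (p i) _ hn fun j hj => ?_
    have hji : blk j = i := blk_eq i j hj.1.2 (lt_of_lt_of_le hj.2 (q_le i n (by omega)))
    have : j ∈ B k := mem_biUnion (x := n) (by simpa using hk.le) hj.1.1
    change b j ∈ x
    simp only [b, hji, i, Nat.unpair_pair, this, if_true]
    exact hl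

/-! ### Large families -/

/-- A family which is not a countable union of non-dominating ones. -/
def IsLarge (I : Order.Ideal (Set ℕ)) (X : Set (Set ℕ)) : Prop :=
  ∀ Y : ℕ → Set (Set ℕ), X ⊆ ⋃ n, Y n → ∃ n, IsDominating I (Y n)

theorem isLarge_of_not_rudinBlassLE (I : Order.Ideal (Set ℕ)) (hI : ∀ n : ℕ, {n} ∈ I)
    (h : ¬ RudinBlassLE idealOne I) : IsLarge I (I : Set (Set ℕ)) := fun Y hY => by
  by_contra hn
  push Not at hn
  exact h (rudinBlassLE_of_cover I hI Y (fun x hx => mem_iUnion.1 (hY hx)) hn)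

theorem IsLarge.isDominating {I : Order.Ideal (Set ℕ)} {X : Set (Set ℕ)} (h : IsLarge I X) :
    IsDominating I X := by
  obtain ⟨_, hn⟩ := h (fun _ => X) (subset_iUnion (fun _ : ℕ => X) 0)
  exact hn

/-- Non-large families form a σ-ideal. The cover `W` is placed on the even indices and the covers of
the `Y i` on the odd ones. -/
theorem IsLarge.of_union {I : Order.Ideal (Set ℕ)} {ι : Type*} [Countable ι]
    {X : Set (Set ℕ)} {Z : Set (Set ℕ)} {Y : ι → Set (Set ℕ)} (hX : IsLarge I X)
    (hsub : X ⊆ Z ∪ ⋃ i, Y i) (hY : ∀ i, ¬ IsLarge I (Y i)) : IsLarge I Z := by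
  intro W hW
  by_contra hn
  push Not at hn
  simp only [IsLarge] at hY
  push Not at hY
  choose V hV hV' using hY
  rcases isEmpty_or_nonempty ι with hι | hι
  · obtain ⟨n, h⟩ := hX W (by simpa using hsub.trans (union_subset_union_left _ hW))
    exact hn n h
  obtain ⟨e, he⟩ := exists_surjective_nat ι
  obtain ⟨n, h⟩ := hX (fun n => if n % 2 = 0 then W (n / 2)
      else V (e (Nat.unpair (n / 2)).1) (Nat.unpair (n / 2)).2) (by
    intro x hx
    rcases hsub hx with h | h
    · obtain ⟨n, hn⟩ := mem_iUnion.1 (hW h)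
      refine mem_iUnion.2 ⟨2 * n, ?_⟩
      simpa using hn
    · obtain ⟨i, hi⟩ := mem_iUnion.1 h
      obtain ⟨m, rfl⟩ := he i
      obtain ⟨n, hn⟩ := mem_iUnion.1 (hV _ hi)
      refine mem_iUnion.2 ⟨2 * Nat.pair m n + 1, ?_⟩
      have : (2 * Nat.pair m n + 1) / 2 = Nat.pair m n := by omega
      simpa [this, Nat.add_mod] using hn)
  by_cases h2 : n % 2 = 0
  · simp only [h2, if_true] at h; exact hn _ h
  · simp only [h2, if_false] at h; exact hV' _ _ h

/-! ### Large points of Baire space and fusion -/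

/-- The basic open subset of Baire space given by a finite sequence. -/
def natCylinder (u : Σ k, Fin k → ℕ) : Set (ℕ → ℕ) := {α | ∀ i : Fin u.1, α i = u.2 i}

/-- The initial segment of length `k` of `α`. -/
def initialSegment (α : ℕ → ℕ) (k : ℕ) : Σ k, Fin k → ℕ := ⟨k, fun i => α i⟩

theorem mem_natCylinder_initialSegment {α γ : ℕ → ℕ} {k : ℕ} :
    γ ∈ natCylinder (initialSegment α k) ↔ ∀ i < k, γ i = α i :=
  ⟨fun h i hi => h ⟨i, hi⟩, fun h i => h i i.2⟩

/-- The points all of whose neighbourhoods have a large image. -/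
def largePoints (I : Order.Ideal (Set ℕ)) (f : (ℕ → ℕ) → Set ℕ) : Set (ℕ → ℕ) :=
  {α | ∀ k, IsLarge I (f '' natCylinder (initialSegment α k))}

theorem isLarge_image_inter_largePoints {I : Order.Ideal (Set ℕ)} {f : (ℕ → ℕ) → Set ℕ}
    {S : Set (ℕ → ℕ)} (h : IsLarge I (f '' S)) : IsLarge I (f '' (S ∩ largePoints I f)) := by
  -- There are only countably many cylinders, so discarding every point that has a non-large
  -- neighbourhood does not destroy largeness.
  refine h.of_union (ι := {u : Σ k, Fin k → ℕ // ¬ IsLarge I (f '' natCylinder u)})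
    (Y := fun u => f '' natCylinder u.1) ?_ (fun u => u.2)
  rintro _ ⟨α, hα, rfl⟩
  by_cases hG : α ∈ largePoints I f
  · exact Or.inl ⟨α, ⟨hα, hG⟩, rfl⟩
  · simp only [largePoints, mem_ofPred_eq, not_forall] at hG
    obtain ⟨k, hk⟩ := hG
    exact Or.inr (mem_iUnion.2 ⟨⟨_, hk⟩, α, mem_natCylinder_initialSegment.2 fun _ _ => rfl, rfl⟩)

/-- Neighbourhoods of large points. -/
abbrev LargeNhd (I : Order.Ideal (Set ℕ)) (f : (ℕ → ℕ) → Set ℕ) : Type :=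
  {p : (ℕ → ℕ) × ℕ // p.1 ∈ largePoints I f}

namespace LargeNhd

variable {I : Order.Ideal (Set ℕ)} {f : (ℕ → ℕ) → Set ℕ}

/-- The large points in the given neighbourhood. -/
def carrier (s : LargeNhd I f) : Set (ℕ → ℕ) :=
  natCylinder (initialSegment s.1.1 s.1.2) ∩ largePoints I f

/-- `t` is a smaller neighbourhood than `s`. -/
def Extends (t s : LargeNhd I f) : Prop :=
  s.1.2 < t.1.2 ∧ ∀ i < s.1.2, t.1.1 i = s.1.1 i

/-- The closed family attached to a neighbourhood. -/
def family (s : LargeNhd I f) : Set (Set ℕ) := closedHull (f '' s.carrier)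

theorem isDominating (s : LargeNhd I f) : IsDominating I (f '' s.carrier) :=
  (isLarge_image_inter_largePoints (s.2 s.1.2)).isDominating

theorem isAbsorbing (s : LargeNhd I f) : IsAbsorbing I s.family :=
  s.isDominating.isAbsorbing

/-- A finite part of `x` is covered by some `f β` with `β` a large point; by continuity a long
enough initial segment of `β` already forces the covering. -/
theorem exists_extends (hf : ∀ α m, ∃ k, ∀ γ, (∀ i < k, γ i = α i) → f γ ∩ Iio m = f α ∩ Iio m)
    (s : LargeNhd I f) {x : Set ℕ} (hx : x ∈ s.family) (m : ℕ) :
    ∃ t : LargeNhd I f, t.Extends s ∧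
      ∀ γ, (∀ i < t.1.2, γ i = t.1.1 i) → x ∩ Iio m ⊆ f γ := by
  obtain ⟨_, ⟨β, hβ, rfl⟩, h⟩ := hx m
  obtain ⟨k, hk⟩ := hf β m
  refine ⟨⟨(β, max k (s.1.2 + 1)), hβ.2⟩,
    ⟨lt_of_lt_of_le (Nat.lt_succ_self _) (le_max_right _ _),
      mem_natCylinder_initialSegment.1 hβ.1⟩, fun γ hγ j hj => ?_⟩
  have := hk γ fun i hi => hγ i (lt_of_lt_of_le hi (le_max_left _ _))
  have hj' : j ∈ f β ∩ Iio m := ⟨h hj, hj.2⟩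
  rw [← this] at hj'
  exact hj'.1

theorem exists_limit (s : ℕ → LargeNhd I f) (h : ∀ n, (s (n + 1)).Extends (s n)) :
    ∃ γ : ℕ → ℕ, ∀ n, ∀ i < (s n).1.2, γ i = (s n).1.1 i := by
  have hlen : ∀ n, n ≤ (s n).1.2 := fun n => by
    induction n with
    | zero => exact Nat.zero_le _
    | succ n ih => have := (h n).1; omega
  have hmono : ∀ n d, (s n).1.2 ≤ (s (n + d)).1.2 ∧
      ∀ i < (s n).1.2, (s (n + d)).1.1 i = (s n).1.1 i := by
    intro n d
    induction d with
    | zero => exact ⟨le_rfl, fun _ _ => rfl⟩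
    | succ d ih =>
      refine ⟨ih.1.trans (h (n + d)).1.le, fun i hi => ?_⟩
      rw [← ih.2 i hi]
      exact (h (n + d)).2 i (lt_of_lt_of_le hi ih.1)
  -- The segment of `s (i + 1)` has length at least `i + 1`, so its value at `i` is final.
  refine ⟨fun i => (s (i + 1)).1.1 i, fun n i hi => ?_⟩
  rcases le_total n (i + 1) with hn | hn
  · obtain ⟨d, hd⟩ := Nat.exists_eq_add_of_le hn
    simp only [hd]
    exact (hmono n d).2 i hi
  · obtain ⟨d, rfl⟩ := Nat.exists_eq_add_of_le hn
    exact ((hmono (i + 1) d).2 i (hlen (i + 1))).symm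

/-- A tail of `x` is covered by `f α ∪ f β`, with `α` and `β` capturing alternate intervals of `x`.
Two branches are needed because a new neighbourhood controls `x` only beyond an index known after it
is chosen; the other branch bridges that gap. -/
theorem mem_of_forall_family (hf : ∀ α m, ∃ k, ∀ γ, (∀ i < k, γ i = α i) →
      f γ ∩ Iio m = f α ∩ Iio m) (hfI : ∀ α, f α ∈ I) (hI : ∀ n : ℕ, {n} ∈ I)
    (s₀ : LargeNhd I f) {x : Set ℕ} (hx : ∀ s : LargeNhd I f, ∃ n, x ∩ Ici n ∈ s.family) :
    x ∈ I := by
  choose n hn using hx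
  choose g hg hg' using fun (s : LargeNhd I f) (m : ℕ) => exists_extends hf s (hn s) m
  -- The entries are the active neighbourhood, the waiting one and the current cut. The next cut is
  -- past the index at which the waiting neighbourhood takes control of `x`.
  let r : ℕ → LargeNhd I f × LargeNhd I f × ℕ := fun i => Nat.rec (s₀, s₀, n s₀)
    (fun _ p => (p.2.1, g p.1 (max (p.2.2 + 1) (n p.2.1)), max (p.2.2 + 1) (n p.2.1))) i
  have r_succ : ∀ i, r (i + 1) = ((r i).2.1, g (r i).1 (max ((r i).2.2 + 1) (n (r i).2.1)),
      max ((r i).2.2 + 1) (n (r i).2.1)) := fun i => rfl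
  have r_two : ∀ i, (r (i + 2)).1 = g (r i).1 (r (i + 1)).2.2 := fun i => rfl
  have hm : ∀ i, n (r i).1 ≤ (r i).2.2 := by
    rintro (_ | i)
    · exact le_rfl
    · rw [r_succ]; exact le_max_right _ _
  have hext : ∀ i, (r (i + 2)).1.Extends (r i).1 := fun i => by
    rw [r_two]; exact hg _ _
  obtain ⟨α, hα⟩ := exists_limit (fun i => (r (2 * i)).1) fun i => hext (2 * i)
  obtain ⟨β, hβ⟩ := exists_limit (fun i => (r (2 * i + 1)).1) fun i => hext (2 * i + 1)
  have hcov : ∀ i, x ∩ Ici (r i).2.2 ∩ Iio (r (i + 1)).2.2 ⊆ f α ∪ f β := by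
    intro i
    have key : ∀ γ, (∀ j < (r (i + 2)).1.1.2, γ j = (r (i + 2)).1.1.1 j) →
        x ∩ Ici (r i).2.2 ∩ Iio (r (i + 1)).2.2 ⊆ f γ := fun γ hγ j hj => by
      rw [r_two] at hγ
      exact hg' _ _ γ hγ ⟨⟨hj.1.1, (hm i).trans hj.1.2⟩, hj.2⟩
    rcases Nat.even_or_odd' i with ⟨c, rfl | rfl⟩
    · exact (key α (hα (c + 1))).trans subset_union_left
    · exact (key β (hβ (c + 1))).trans subset_union_right
  have hmono : StrictMono fun i => (r i).2.2 := strictMono_nat_of_lt_succ fun i => by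
    rw [r_succ]; exact lt_of_lt_of_le (Nat.lt_succ_self _) (le_max_left _ _)
  have hcov' : ∀ i, x ∩ Ici (r 0).2.2 ∩ Iio (r i).2.2 ⊆ f α ∪ f β := by
    intro i
    induction i with
    | zero => exact fun j hj => (not_lt.2 (mem_Ici.1 hj.1.2) (mem_Iio.1 hj.2)).elim
    | succ i ih =>
      intro j hj
      rcases lt_or_ge j (r i).2.2 with h | h
      · exact ih ⟨hj.1, h⟩
      · exact hcov i ⟨⟨hj.1.1, h⟩, hj.2⟩
  have hsub : x ⊆ Iio (r 0).2.2 ∪ (f α ∪ f β) := fun j hj => by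
    rcases lt_or_ge j (r 0).2.2 with h | h
    · exact Or.inl h
    · exact Or.inr (hcov' (j + 1) ⟨⟨hj, h⟩, hmono.le_apply (x := j + 1)⟩)
  exact ideal_subset_mem I hsub (ideal_union_mem I (ideal_finite_mem I hI (finite_Iio _))
    (ideal_union_mem I (hfI α) (hfI β)))

/-- If no half exists, then for each `n` the branches can be extended so that `f α ∪ f β` picks up
beyond `n` a finite set outside `L`. Then no tail of `f α ∪ f β ∈ I` is in `L`, although `L` is
absorbing. -/
theorem exists_half (hf : ∀ α m, ∃ k, ∀ γ, (∀ i < k, γ i = α i) →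
      f γ ∩ Iio m = f α ∩ Iio m) (hfI : ∀ α, f α ∈ I) (s₀ : LargeNhd I f)
    {L : Set (Set ℕ)} (hL : IsAbsorbing I L) :
    ∃ L', IsAbsorbing I L' ∧ ∀ x ∈ L', ∀ y ∈ L', x ∪ y ∈ L := by
  by_contra hno
  push Not at hno
  have step : ∀ (s t : LargeNhd I f) (n : ℕ), ∃ (x y : Set ℕ) (m : ℕ) (s' t' : LargeNhd I f),
      x ∪ y ⊆ Ici n ∧ (x ∪ y) ∩ Iio m ∉ L ∧ s'.Extends s ∧ t'.Extends t ∧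
      (∀ γ, (∀ i < s'.1.2, γ i = s'.1.1 i) → x ∩ Iio m ⊆ f γ) ∧
      (∀ γ, (∀ i < t'.1.2, γ i = t'.1.1 i) → y ∩ Iio m ⊆ f γ) := by
    intro s t n
    have hn : IsAbsorbing I {x | x ⊆ Ici n} :=
      ⟨fun _ _ h hy => h.trans hy, fun x h j hj => h (j + 1) ⟨hj, Nat.lt_succ_self j⟩,
        fun x _ => ⟨n, inter_subset_right⟩⟩
    obtain ⟨x, hx, y, hy, hxy⟩ := hno _ ((s.isAbsorbing.inter t.isAbsorbing).inter hn)
    obtain ⟨m, hm⟩ : ∃ m, (x ∪ y) ∩ Iio m ∉ L := by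
      by_contra h
      push Not at h
      exact hxy (hL.closed h)
    obtain ⟨s', h1, h2⟩ := exists_extends hf s hx.1.1 m
    obtain ⟨t', h3, h4⟩ := exists_extends hf t hy.1.2 m
    exact ⟨x, y, m, s', t', union_subset hx.2 hy.2, hm, h1, h3, h2, h4⟩
  choose x y m S T hsub hnot hS hT hx hy using step
  let r : ℕ → LargeNhd I f × LargeNhd I f := fun i =>
    Nat.rec (s₀, s₀) (fun i p => (S p.1 p.2 i, T p.1 p.2 i)) i
  obtain ⟨α, hα⟩ := exists_limit (fun i => (r i).1) fun i => hS _ _ _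
  obtain ⟨β, hβ⟩ := exists_limit (fun i => (r i).2) fun i => hT _ _ _
  obtain ⟨n, hn⟩ := hL.absorb (ideal_union_mem I (hfI α) (hfI β))
  refine hnot (r n).1 (r n).2 n (hL.hereditary ?_ hn)
  rintro j ⟨hj, hjm⟩
  refine ⟨?_, hsub _ _ _ hj⟩
  rcases hj with hj | hj
  · exact Or.inl (hx (r n).1 (r n).2 n α (hα (n + 1)) ⟨hj, hjm⟩)
  · exact Or.inr (hy (r n).1 (r n).2 n β (hβ (n + 1)) ⟨hj, hjm⟩)

end LargeNhd

/-- A large ideal which is a continuous image of Baire space is exhaustive. -/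
theorem exists_eq_exh_of_isLarge (I : Order.Ideal (Set ℕ)) (hI : ∀ n : ℕ, {n} ∈ I)
    (hlarge : IsLarge I (I : Set (Set ℕ))) (f : (ℕ → ℕ) → Set ℕ) (hfI : range f = I)
    (hf : ∀ α m, ∃ k, ∀ γ, (∀ i < k, γ i = α i) → f γ ∩ Iio m = f α ∩ Iio m) :
    ∃ φ : LscSubmeasure, I = φ.exh := by
  have hfI' : ∀ α, f α ∈ I := fun α => by
    have : f α ∈ range f := mem_range_self α
    rwa [hfI] at this
  obtain ⟨s₀⟩ : Nonempty (LargeNhd I f) := by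
    rw [← hfI, ← image_univ] at hlarge
    obtain ⟨n, hn⟩ := (isLarge_image_inter_largePoints hlarge).isDominating ∅ I.bot_mem
    obtain ⟨_, ⟨α, hα, -⟩, -⟩ := hn 0
    exact ⟨⟨(α, 0), hα.2⟩⟩
  obtain ⟨e, he⟩ := exists_surjective_nat (Σ k, Fin k → ℕ)
  classical
  -- The value `univ` is absorbing and imposes no condition, so all cylinders can be enumerated.
  let F : ℕ → Set (Set ℕ) := fun n =>
    if IsDominating I (f '' (natCylinder (e n) ∩ largePoints I f)) then
      closedHull (f '' (natCylinder (e n) ∩ largePoints I f)) else univ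
  refine exists_eq_exh_of_absorbing I F (fun n => ?_) (fun x hx => ?_)
    (fun L hL => LargeNhd.exists_half hf hfI' s₀ hL)
  · by_cases h : IsDominating I (f '' (natCylinder (e n) ∩ largePoints I f))
    · simp only [F, h, if_true]; exact h.isAbsorbing
    · simp only [F, h, if_false]; exact isAbsorbing_univ I
  · refine LargeNhd.mem_of_forall_family hf hfI' hI s₀ fun s => ?_
    obtain ⟨n, hn⟩ := he (initialSegment s.1.1 s.1.2)
    obtain ⟨m, hm⟩ := hx n
    have h := s.isDominating
    simp only [F, hn] at hm
    rw [if_pos (show IsDominating I (f '' (natCylinder (initialSegment s.1.1 s.1.2) ∩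
      largePoints I f)) from h)] at hm
    exact ⟨m, hm⟩

/-! ### Topology of the power set and the `Π⁰₃` bound -/

open Filter Topology MeasureTheory

section PowersetTopology

attribute [local instance] powersetTopology

/-- The power set is homeomorphic to `{0,1}^α`. -/
noncomputable def powersetHomeomorph (α : Type*) : Set α ≃ₜ (α → Bool) :=
  Equiv.toHomeomorphOfIsInducing
    { toFun := fun (x : Set α) (a : α) => (open Classical in decide (a ∈ x))
      invFun := fun g => {a | g a = true}
      left_inv := fun x => by ext a; simp
      right_inv := fun g => by ext a; simp } ⟨rfl⟩

theorem powerset_compactSpace (α : Type*) : CompactSpace (Set α) :=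
  (powersetHomeomorph α).symm.compactSpace

theorem powerset_t2Space (α : Type*) : T2Space (Set α) :=
  (powersetHomeomorph α).isEmbedding.t2Space

theorem powerset_secondCountable (α : Type*) [Countable α] : SecondCountableTopology (Set α) :=
  (powersetHomeomorph α).secondCountableTopology

theorem powerset_baireSpace (α : Type*) : BaireSpace (Set α) := by
  have := powerset_compactSpace α
  have := powerset_t2Space α
  infer_instance

theorem continuous_to_powerset {α X : Type*} [TopologicalSpace X] {g : X → Set α}
    (h : ∀ a, IsClopen {x | a ∈ g x}) : Continuous g := by
  classical
  rw [continuous_induced_rng, continuous_pi_iff]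
  intro a
  rw [continuous_bool_rng true]
  convert h a using 1
  ext x; simp

theorem isClopen_mem_powerset {α : Type*} (a : α) : IsClopen {x : Set α | a ∈ x} := by
  classical
  have := (isClopen_discrete {true}).preimage
    ((continuous_apply a).comp (powersetHomeomorph α).continuous)
  convert this using 1
  ext x; simp [powersetHomeomorph]

theorem tendsto_powerset {α ι : Type*} {l : Filter ι} {u : ι → Set α} {x : Set α} :
    Tendsto u l (𝓝 x) ↔ ∀ a, ∀ᶠ i in l, (a ∈ u i ↔ a ∈ x) := by
  classical
  rw [nhds_induced, tendsto_comap_iff, tendsto_pi_nhds]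
  refine forall_congr' fun a => ?_
  simp [nhds_discrete, tendsto_pure]

theorem eventually_inter_Iio_eq (x : Set ℕ) (m : ℕ) : ∀ᶠ y in 𝓝 x, y ∩ Iio m = x ∩ Iio m := by
  have h : ∀ᶠ y in 𝓝 x, ∀ i ∈ Iio m, (i ∈ y ↔ i ∈ x) :=
    (finite_Iio m).eventually_all.2 fun i _ => tendsto_powerset.1 tendsto_id i
  filter_upwards [h] with y hy
  ext i
  exact ⟨fun h => ⟨(hy i h.2).1 h.1, h.2⟩, fun h => ⟨(hy i h.2).2 h.1, h.2⟩⟩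

/-- If `x ∩ [0, m)` is not in `C`, then by heredity no `y` agreeing with `x` below `m` is in `C`. -/
theorem isClosed_of_hereditary_closed {C : Set (Set ℕ)}
    (hher : ∀ x y : Set ℕ, x ⊆ y → y ∈ C → x ∈ C) (hC : ∀ x : Set ℕ, (∀ m, x ∩ Iio m ∈ C) → x ∈ C) :
    IsClosed C := by
  rw [← isOpen_compl_iff, isOpen_iff_mem_nhds]
  intro x hx
  have : ∃ m, x ∩ Iio m ∉ C := by
    by_contra h; push Not at h; exact hx (hC x h)
  obtain ⟨m, hm⟩ := this
  filter_upwards [eventually_inter_Iio_eq x m] with y hy hyC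
  exact hm (hy ▸ hher _ _ inter_subset_left hyC)

/-- Lower semicontinuity makes each condition `φ (x ∩ [m, ∞)) ≤ 2⁻ⁿ` closed. -/
theorem LscSubmeasure.isPiZeroThree_exh (φ : LscSubmeasure) :
    IsPiZeroThree (φ.exh : Set (Set ℕ)) := by
  refine ⟨fun n m => {x | φ.toFun (x ∩ Ici m) ≤ 2⁻¹ ^ n}, fun n m => ?_, ?_⟩
  · refine isClosed_of_hereditary_closed (fun x y h hy => ?_) fun x hx => ?_
    · exact (φ.mono (inter_subset_inter_left _ h)).trans hy
    · change φ.toFun _ ≤ _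
      rw [φ.lsc]
      refine iSup_le fun j => ?_
      have := hx j
      rwa [mem_ofPred_eq, inter_right_comm] at this
  · ext x
    simp only [mem_iInter, mem_iUnion, mem_ofPred_eq]
    change φ.tail x = 0 ↔ _
    constructor
    · intro h n
      have : φ.tail x < 2⁻¹ ^ n := by rw [h]; exact ENNReal.pow_pos (by simp) _
      exact (iInf_lt_iff.1 this).imp fun _ => le_of_lt
    · intro h
      refine le_antisymm (ENNReal.le_of_forall_pos_le_add fun ε hε _ => ?_) zero_le
      obtain ⟨n, hn⟩ := ENNReal.exists_inv_two_pow_lt (ENNReal.coe_ne_zero.2 hε.ne')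
      obtain ⟨m, hm⟩ := h n
      rw [zero_add]
      exact (iInf_le _ m).trans (hm.trans hn.le)

/-- Analytic ideals which are not Rudin-Blass above `I₁` are exhaustive. -/
theorem exists_eq_exh_of_not_rudinBlassLE (I : Order.Ideal (Set ℕ)) (hI : ∀ n : ℕ, {n} ∈ I)
    (han : IsAnalyticIdeal I) (h : ¬ RudinBlassLE idealOne I) : ∃ φ : LscSubmeasure, I = φ.exh := by
  rw [IsAnalyticIdeal, AnalyticSet] at han
  rcases han with han | ⟨f, hf, hfI⟩
  · exact absurd I.nonempty (by rw [han]; exact not_nonempty_empty)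
  refine exists_eq_exh_of_isLarge I hI (isLarge_of_not_rudinBlassLE I hI h) f hfI fun α m => ?_
  have h1 : ∀ᶠ γ in 𝓝 α, f γ ∩ Iio m = f α ∩ Iio m :=
    (hf.tendsto α).eventually (eventually_inter_Iio_eq (f α) m)
  obtain ⟨k, hk⟩ := ((PiNat.isTopologicalBasis_cylinders (fun _ : ℕ => ℕ)).mem_nhds_iff).1 h1
  obtain ⟨⟨β, k, rfl⟩, hα, hsub⟩ := hk
  refine ⟨k, fun γ hγ => hsub fun i hi => ?_⟩
  rw [hγ i hi]; exact hα i hi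

/-! ### Exhaustive ideals are polishable -/

/-- An exhaustive ideal is given by a submeasure which is positive on singletons. -/
theorem LscSubmeasure.exists_pos (φ : LscSubmeasure) :
    ∃ ψ : LscSubmeasure, ψ.exh = φ.exh ∧ ∀ n, 0 < ψ.toFun {n} := by
  -- For nonempty `x` this is `2⁻ᵏ` with `k = min x`: a submeasure, positive on singletons, whose
  -- tails tend to `0`, so adding it leaves `Exh` unchanged.
  let ρ : Set ℕ → ℝ≥0∞ := fun x => ⨆ n ∈ x, 2⁻¹ ^ n
  have ρ_mono : ∀ {x y : Set ℕ}, x ⊆ y → ρ x ≤ ρ y := fun h => biSup_mono fun _ hn => h hn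
  have ρ_tail : ∀ (x : Set ℕ) n, ρ (x ∩ Ici n) ≤ 2⁻¹ ^ n := fun x n =>
    iSup₂_le fun k hk => pow_le_pow_right_of_le_one' (by simp) hk.2
  let ψ : LscSubmeasure :=
    { toFun := fun x => φ.toFun x + ρ x
      map_empty := by simp [φ.map_empty, ρ]
      map_singleton_lt_top := fun n => ENNReal.add_lt_top.2 ⟨φ.map_singleton_lt_top n, by
        simp [ρ]⟩
      le_map_union := fun x y => add_le_add (φ.le_map_union x y) (ρ_mono subset_union_left)
      map_union_le := fun x y => by
        rw [add_add_add_comm]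
        refine add_le_add (φ.map_union_le x y) (iSup₂_le ?_)
        rintro n (hn | hn)
        · exact le_add_right (le_iSup₂ (f := fun n (_ : n ∈ x) => (2⁻¹ : ℝ≥0∞) ^ n) n hn)
        · exact le_add_left (le_iSup₂ (f := fun n (_ : n ∈ y) => (2⁻¹ : ℝ≥0∞) ^ n) n hn)
      lsc := fun x => by
        have hρ : ρ x = ⨆ n : ℕ, ρ (x ∩ Iio n) := by
          refine le_antisymm (iSup₂_le fun n hn => ?_) (iSup_le fun n => ρ_mono inter_subset_left)
          exact le_iSup_of_le (n + 1) (le_iSup₂ (f := fun k (_ : k ∈ x ∩ Iio (n + 1)) =>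
            (2⁻¹ : ℝ≥0∞) ^ k) n ⟨hn, Nat.lt_succ_self n⟩)
        rw [hρ, φ.lsc x]
        refine ENNReal.iSup_add_iSup_of_monotone ?_ ?_
        · exact fun a b h => φ.mono (inter_subset_inter_right _ (Iio_subset_Iio h))
        · exact fun a b h => ρ_mono (inter_subset_inter_right _ (Iio_subset_Iio h)) }
  refine ⟨ψ, ?_, fun n => lt_of_lt_of_le (ENNReal.pow_pos (by simp) n)
    (show (2⁻¹ : ℝ≥0∞) ^ n ≤ φ.toFun {n} + ρ {n} by simp [ρ])⟩
  ext x
  change ψ.tail x = 0 ↔ φ.tail x = 0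
  constructor
  · intro h
    refine le_antisymm (h ▸ iInf_mono fun n => ?_) zero_le
    exact le_self_add
  · intro h
    have h2 : (⨅ n : ℕ, (2⁻¹ : ℝ≥0∞) ^ n) = 0 := le_antisymm
      (ENNReal.le_of_forall_pos_le_add fun ε hε _ => by
        obtain ⟨n, hn⟩ := ENNReal.exists_inv_two_pow_lt (ENNReal.coe_ne_zero.2 hε.ne')
        rw [zero_add]; exact (iInf_le _ n).trans hn.le) zero_le
    have : ψ.tail x ≤ φ.tail x + ⨅ n : ℕ, (2⁻¹ : ℝ≥0∞) ^ n := by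
      refine ENNReal.le_iInf_add_iInf (f := fun n => φ.toFun (x ∩ Ici n)) fun i j => ?_
      refine (iInf_le _ (max i j)).trans (add_le_add (φ.mono ?_) ((ρ_tail _ _).trans ?_))
      · exact inter_subset_inter_right _ (Ici_subset_Ici.2 (le_max_left i j))
      · exact pow_le_pow_right_of_le_one' (by simp) (le_max_right i j)
    rw [h, h2, add_zero] at this
    exact le_antisymm this zero_le

theorem LscSubmeasure.mem_exh_iff (φ : LscSubmeasure) {x : Set ℕ} :
    x ∈ φ.exh ↔ ∀ ε : ℝ≥0∞, 0 < ε → ∃ n, φ.toFun (x ∩ Ici n) < ε := by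
  change φ.tail x = 0 ↔ _
  refine ⟨fun h ε hε => iInf_lt_iff.1 (show φ.tail x < ε by rwa [h]), fun h => ?_⟩
  by_contra h0
  obtain ⟨n, hn⟩ := h _ (pos_iff_ne_zero.2 h0)
  exact absurd hn (not_lt.2 (iInf_le _ n))

end PowersetTopology

/-- The extended distance `φ (x ∆ y)` on `Exh_φ`. -/
noncomputable abbrev LscSubmeasure.emetric (φ : LscSubmeasure) (hφ : ∀ n, 0 < φ.toFun {n}) :
    EMetricSpace {x : Set ℕ // x ∈ φ.exh} where
  edist x y := φ.toFun (x.1 ∆ y.1)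
  edist_self x := by rw [symmDiff_self]; exact φ.map_empty
  edist_comm x y := by rw [symmDiff_comm]
  edist_triangle x y z :=
    (φ.mono (symmDiff_triangle x.1 y.1 z.1)).trans (φ.map_union_le _ _)
  eq_of_edist_eq_zero {x y} h := by
    refine Subtype.ext (symmDiff_eq_bot.1 (eq_empty_iff_forall_notMem.2 fun n hn => ?_))
    exact absurd ((φ.mono (singleton_subset_iff.2 hn)).trans h.le) (not_le.2 (hφ n))

namespace LscSubmeasure

variable (φ : LscSubmeasure) (hφ : ∀ n, 0 < φ.toFun {n})

/-- Positivity on `{k}` makes membership of `k` in `u n` eventually constant, which defines the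
limit. Lower semicontinuity carries the Cauchy bounds over to it. -/
theorem exists_limit (hφ : ∀ n, 0 < φ.toFun {n}) {u : ℕ → Set ℕ} (hu : ∀ n, u n ∈ φ.exh)
    (h : ∀ N n m : ℕ, N ≤ n → N ≤ m → φ.toFun (u n ∆ u m) < 2⁻¹ ^ N) :
    ∃ x ∈ φ.exh, ∀ n, φ.toFun (u n ∆ x) ≤ 2⁻¹ ^ n := by
  let x : Set ℕ := {k | ∀ᶠ n in atTop, k ∈ u n}
  have hx : ∀ k, ∀ᶠ n in atTop, (k ∈ u n ↔ k ∈ x) := by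
    intro k
    obtain ⟨N, hN⟩ := ENNReal.exists_inv_two_pow_lt (hφ k).ne'
    have hst : ∀ n, N ≤ n → (k ∈ u n ↔ k ∈ u N) := fun n hn => by
      by_contra hne
      have : k ∈ u n ∆ u N := by rw [mem_symmDiff]; tauto
      exact absurd ((φ.mono (singleton_subset_iff.2 this)).trans (h N n N hn le_rfl).le)
        (not_le.2 hN)
    by_cases hk : k ∈ u N
    · have : k ∈ x := eventually_atTop.2 ⟨N, fun n hn => (hst n hn).2 hk⟩
      exact eventually_atTop.2 ⟨N, fun n hn => by simp [hst n hn, hk, this]⟩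
    · have : k ∉ x := fun hkx => by
        obtain ⟨n, h1, h2⟩ := (hkx.and (eventually_ge_atTop N)).exists
        exact hk ((hst n h2).1 h1)
      exact eventually_atTop.2 ⟨N, fun n hn => by simp [hst n hn, hk, this]⟩
  have hle : ∀ n, φ.toFun (u n ∆ x) ≤ 2⁻¹ ^ n := by
    intro n
    rw [φ.lsc]
    refine iSup_le fun m => ?_
    obtain ⟨p, hp, hnp⟩ := (((finite_Iio m).eventually_all.2 fun k _ => hx k).and
      (eventually_ge_atTop n)).exists
    refine (φ.mono ?_).trans (h n n p le_rfl hnp).le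
    rintro k ⟨hk, hkm⟩
    rw [mem_symmDiff] at hk ⊢
    rwa [hp k hkm]
  refine ⟨x, φ.mem_exh_iff.2 fun ε hε => ?_, hle⟩
  obtain ⟨N, hN⟩ := ENNReal.exists_inv_two_pow_lt (ENNReal.half_pos hε.ne').ne'
  obtain ⟨n, hn⟩ := φ.mem_exh_iff.1 (hu N) _ (ENNReal.half_pos hε.ne')
  refine ⟨n, lt_of_le_of_lt ((φ.mono ?_).trans (φ.map_union_le (u N ∩ Ici n) (u N ∆ x))) ?_⟩
  · rintro k ⟨hk, hkn⟩
    by_cases h : k ∈ u N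
    · exact Or.inl ⟨h, hkn⟩
    · exact Or.inr (mem_symmDiff.2 (Or.inr ⟨hk, h⟩))
  · rw [← ENNReal.add_halves ε]
    exact ENNReal.add_lt_add hn ((hle N).trans_lt hN)

theorem completeSpace_emetric :
    @CompleteSpace _ (φ.emetric hφ).toUniformSpace := by
  let := φ.emetric hφ
  refine EMetric.complete_of_convergent_controlled_sequences (fun n => 2⁻¹ ^ n)
    (fun n => ENNReal.pow_pos (by simp) n) fun u hu => ?_
  obtain ⟨x, hx, hle⟩ := φ.exists_limit hφ (fun n => (u n).2) hu
  refine ⟨⟨x, hx⟩, EMetric.tendsto_atTop.2 fun ε hε => ?_⟩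
  obtain ⟨N, hN⟩ := ENNReal.exists_inv_two_pow_lt hε.ne'
  exact ⟨N, fun n hn => ((hle n).trans (pow_le_pow_right_of_le_one' (by simp) hn)).trans_lt hN⟩

theorem separableSpace_emetric :
    @TopologicalSpace.SeparableSpace _ (φ.emetric hφ).toUniformSpace.toTopologicalSpace := by
  let := φ.emetric hφ
  let g : Finset ℕ → {x : Set ℕ // x ∈ φ.exh} := fun F =>
    ⟨F, ideal_finite_mem _ φ.singleton_mem_exh F.finite_toSet⟩
  refine ⟨range g, countable_range g, fun x => EMetric.mem_closure_iff.2 fun ε hε => ?_⟩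
  obtain ⟨n, hn⟩ := φ.mem_exh_iff.1 x.2 ε hε
  classical
  refine ⟨_, ⟨(finite_Iio n).inter_of_right x.1 |>.toFinset, rfl⟩, lt_of_le_of_lt (φ.mono ?_) hn⟩
  intro k hk
  simp only [g, Finite.coe_toFinset, mem_symmDiff] at hk
  rcases hk with ⟨h1, h2⟩ | ⟨h1, h2⟩
  · exact ⟨h1, mem_Ici.2 (not_lt.1 fun h => h2 ⟨h1, mem_Iio.2 h⟩)⟩
  · exact absurd h1.1 h2

theorem continuous_val_emetric :
    @Continuous _ _ (φ.emetric hφ).toUniformSpace.toTopologicalSpace (powersetTopology ℕ)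
      (Subtype.val : {x : Set ℕ // x ∈ φ.exh} → Set ℕ) := by
  let := φ.emetric hφ
  refine continuous_to_powerset fun k => ?_
  have key : ∀ x y : {x : Set ℕ // x ∈ φ.exh}, edist y x < φ.toFun {k} →
      (k ∈ y.1 ↔ k ∈ x.1) := fun x y h => by
    by_contra hne
    have : k ∈ y.1 ∆ x.1 := by rw [mem_symmDiff]; tauto
    exact absurd (φ.mono (singleton_subset_iff.2 this)) (not_le.2 h)
  constructor
  · rw [← isOpen_compl_iff, EMetric.isOpen_iff]
    exact fun x hx => ⟨_, hφ k, fun y hy hky => hx ((key x y hy).1 hky)⟩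
  · rw [EMetric.isOpen_iff]
    exact fun x hx => ⟨_, hφ k, fun y hy => (key x y hy).2 hx⟩

theorem isPolishableIdeal_exh : IsPolishableIdeal φ.exh := by
  obtain ⟨ψ, hψ, hpos⟩ := φ.exists_pos
  rw [← hψ]
  let := ψ.emetric hpos
  have := ψ.completeSpace_emetric hpos
  have := ψ.separableSpace_emetric hpos
  have hP : PolishSpace {x : Set ℕ // x ∈ ψ.exh} := inferInstance
  refine ⟨inferInstance, hP, ?_, ?_⟩
  · refine LipschitzWith.continuous (K := 2) fun p q => ?_
    have h : (p.1.1 ∆ p.2.1) ∆ (q.1.1 ∆ q.2.1) = (p.1.1 ∆ q.1.1) ∆ (p.2.1 ∆ q.2.1) :=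
      symmDiff_symmDiff_symmDiff_comm _ _ _ _
    change ψ.toFun ((p.1.1 ∆ p.2.1) ∆ (q.1.1 ∆ q.2.1)) ≤ _
    rw [h]
    refine (ψ.mono symmDiff_le_sup).trans ((ψ.map_union_le _ _).trans ?_)
    change edist p.1 q.1 + edist p.2 q.2 ≤ _
    rw [Prod.edist_eq, ENNReal.coe_ofNat, two_mul]
    exact add_le_add (le_max_left _ _) (le_max_right _ _)
  · have h1 := ψ.continuous_val_emetric hpos
    have := powerset_t2Space ℕ
    have := powerset_secondCountable ℕ
    have h2 : @T2Space _ (inheritedTopology ψ.exh) :=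
      @Topology.IsEmbedding.t2Space _ _ (inheritedTopology ψ.exh) (powersetTopology ℕ) _ _
        (@Topology.IsEmbedding.mk _ _ (inheritedTopology ψ.exh) (powersetTopology ℕ) _
          (@Topology.IsInducing.mk _ _ (inheritedTopology ψ.exh) (powersetTopology ℕ) _ rfl)
          Subtype.val_injective)
    have h3 : @SecondCountableTopology _ (inheritedTopology ψ.exh) :=
      @TopologicalSpace.secondCountableTopology_induced _ _ (powersetTopology ℕ) _ _
    have h4 : @Continuous _ _ _ (inheritedTopology ψ.exh)
      (id : {x : Set ℕ // x ∈ ψ.exh} → {x : Set ℕ // x ∈ ψ.exh}) := continuous_induced_rng.2 h1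
    -- By Lusin-Souslin, a continuous bijection from a Polish space to a second countable Hausdorff
    -- space preserves Borel sets.
    have := @Continuous.map_borel_eq _ _ _ _ (inheritedTopology ψ.exh) _ _ id h4
      Function.surjective_id
    rwa [MeasurableSpace.map_id] at this

end LscSubmeasure

/-! ### Polishable ideals are analytic P-ideals -/

/-- Borel homomorphisms from Baire groups to separable groups are continuous (Pettis). -/
theorem AddMonoidHom.continuous_of_measurable_of_baireSpace {G H : Type*} [AddCommGroup G]
    [TopologicalSpace G] [ContinuousAdd G] [BaireSpace G] [MeasurableSpace G] [BorelSpace G]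
    [AddCommGroup H] [TopologicalSpace H] [IsTopologicalAddGroup H]
    [TopologicalSpace.SeparableSpace H] [MeasurableSpace H] [OpensMeasurableSpace H]
    (f : G →+ H) (hf : Measurable f) : ContinuousAt f 0 := by
  rw [ContinuousAt, map_zero]
  intro V hV
  obtain ⟨W₀, hW₀, hWV⟩ : ∃ W ∈ 𝓝 (0 : H), ∀ v ∈ W, ∀ w ∈ W, v - w ∈ V := by
    have : Tendsto (fun p : H × H => p.1 - p.2) (𝓝 0 ×ˢ 𝓝 0) (𝓝 0) := by
      have := (continuous_sub (G := H)).tendsto (0, 0)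
      rwa [sub_zero, nhds_prod_eq] at this
    obtain ⟨W, hW, h⟩ := mem_prod_same_iff.1 (this hV)
    exact ⟨W, hW, fun v hv w hw => h (mk_mem_prod hv hw)⟩
  obtain ⟨W, hWW, hWo, hW0⟩ := mem_nhds_iff.1 hW₀
  have : Nonempty H := ⟨0⟩
  let d := TopologicalSpace.denseSeq H
  let E : ℕ → Set G := fun n => {g | f g - d n ∈ W}
  have hEm : ∀ n, MeasurableSet (E n) := fun n =>
    hf (hWo.preimage (continuous_id.sub continuous_const)).measurableSet
  have hEu : ⋃ n, E n = univ := by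
    refine eq_univ_of_forall fun g => mem_iUnion.2 ?_
    have ho : IsOpen {h : H | f g - h ∈ W} := hWo.preimage (continuous_const.sub continuous_id)
    exact (TopologicalSpace.denseRange_denseSeq H).exists_mem_open ho ⟨f g, by simpa using hW0⟩
  obtain ⟨n, hn⟩ : ∃ n, ¬ IsMeagre (E n) := by
    by_contra h
    push Not at h
    have := isMeagre_iUnion h
    rw [hEu] at this
    exact not_isMeagre_of_isOpen isOpen_univ ⟨0, trivial⟩ this
  -- `E n` agrees with an open `U` up to a meagre set. For small `g` the open set `U ∩ (U - g)` is
  -- nonempty, so some `x` has `x` and `x + g` in `E n`, and `f g = f (x + g) - f x ∈ V`.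
  obtain ⟨U, hUo, hEU⟩ := (hEm n).residualEq_isOpen
  have hUne : U.Nonempty := by
    by_contra h
    rw [not_nonempty_iff_eq_empty] at h
    subst h
    refine hn ?_
    filter_upwards [hEU] with g hg hgE
    exact (iff_of_eq hg).1 hgE
  obtain ⟨u, hu⟩ := hUne
  have hN : {g : G | u + g ∈ U} ∈ 𝓝 0 :=
    (hUo.preimage (continuous_const.add continuous_id)).mem_nhds (by simpa using hu)
  refine mem_map.2 ?_
  filter_upwards [hN] with g hg
  have hEU' : ∀ᶠ x in residual G, (x + g ∈ E n ↔ x + g ∈ U) := by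
    have ht := tendsto_residual_of_isOpenMap (Homeomorph.addRight g).continuous
      (Homeomorph.addRight g).isOpenMap
    filter_upwards [ht.eventually hEU] with x hx
    exact iff_of_eq hx
  have hO : IsOpen (U ∩ {x | x + g ∈ U}) :=
    hUo.inter (hUo.preimage (continuous_id.add continuous_const))
  obtain ⟨x, hx1, hx2⟩ : ∃ x, x ∈ E n ∧ x + g ∈ E n := by
    by_contra h
    push Not at h
    refine not_isMeagre_of_isOpen hO ⟨u, hu, hg⟩ ?_
    filter_upwards [hEU, hEU'] with x h1 h2 hxO
    exact h x ((iff_of_eq h1).2 hxO.1) (h2.2 hxO.2)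
  have := hWV _ (hWW hx2) _ (hWW hx1)
  simpa using this

/-- In a completely metrizable space, arbitrarily small steps can be iterated to a limit. -/
theorem exists_tendsto_of_forall_nhds {S : Type*} [TopologicalSpace S]
    [TopologicalSpace.IsCompletelyMetrizableSpace S] (R : ℕ → S → S → Prop)
    (hR : ∀ n y, ∀ U ∈ 𝓝 y, ∃ z ∈ U, R n y z) (y₀ : S) :
    ∃ u : ℕ → S, (∀ n, R n (u n) (u (n + 1))) ∧ ∃ y, Tendsto u atTop (𝓝 y) := by
  let := TopologicalSpace.upgradeIsCompletelyMetrizable S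
  have h : ∀ n y, ∃ z, dist y z ≤ 1 * (1 / 2 : ℝ) ^ n ∧ R n y z := fun n y => by
    obtain ⟨z, hz, hyz⟩ := hR n y _ (Metric.closedBall_mem_nhds y
      (show (0 : ℝ) < 1 * (1 / 2 : ℝ) ^ n by positivity))
    exact ⟨z, by rwa [dist_comm], hyz⟩
  choose g hg hgR using h
  let u : ℕ → S := fun n => Nat.rec y₀ (fun n y => g n y) n
  exact ⟨u, fun n => hgR _ _, cauchySeq_tendsto_of_complete
    (cauchySeq_of_le_geometric (1 / 2) 1 (by norm_num) fun n => hg n (u n))⟩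

/-- The group `(I, ∆)`. -/
abbrev idealAddCommGroup {α : Type*} (I : Order.Ideal (Set α)) :
    AddCommGroup {x : Set α // x ∈ I} where
  add x y := ⟨x.1 ∆ y.1, symmDiff_mem_ideal I x.2 y.2⟩
  add_assoc x y z := Subtype.ext (symmDiff_assoc x.1 y.1 z.1)
  zero := ⟨∅, I.bot_mem⟩
  zero_add x := Subtype.ext (bot_symmDiff x.1)
  add_zero x := Subtype.ext (symmDiff_bot x.1)
  neg x := x
  neg_add_cancel x := Subtype.ext (symmDiff_self x.1)
  add_comm x y := Subtype.ext (symmDiff_comm x.1 y.1)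
  nsmul := @nsmulRec _ ⟨⟨∅, I.bot_mem⟩⟩ ⟨fun x y => ⟨x.1 ∆ y.1, symmDiff_mem_ideal I x.2 y.2⟩⟩
  zsmul := @zsmulRec _ ⟨⟨∅, I.bot_mem⟩⟩ ⟨fun x y => ⟨x.1 ∆ y.1, symmDiff_mem_ideal I x.2 y.2⟩⟩ ⟨id⟩
    (@nsmulRec _ ⟨⟨∅, I.bot_mem⟩⟩ ⟨fun x y => ⟨x.1 ∆ y.1, symmDiff_mem_ideal I x.2 y.2⟩⟩)

/-- The group `(P(α), ∆)`. -/
abbrev powersetAddCommGroup (α : Type*) : AddCommGroup (Set α) where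
  add x y := x ∆ y
  add_assoc := symmDiff_assoc
  zero := ∅
  zero_add := bot_symmDiff
  add_zero := symmDiff_bot
  neg x := x
  neg_add_cancel := symmDiff_self
  add_comm := symmDiff_comm
  nsmul := @nsmulRec _ ⟨∅⟩ ⟨symmDiff⟩
  zsmul := @zsmulRec _ ⟨∅⟩ ⟨symmDiff⟩ ⟨id⟩ (@nsmulRec _ ⟨∅⟩ ⟨symmDiff⟩)

theorem continuous_symmDiff_powerset (α : Type*) :
    @Continuous _ _ (@instTopologicalSpaceProd _ _ (powersetTopology α) (powersetTopology α))
      (powersetTopology α) (fun p : Set α × Set α => p.1 ∆ p.2) := by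
  let := powersetTopology α
  refine continuous_to_powerset fun a => ?_
  have h1 := (isClopen_mem_powerset a).preimage (continuous_fst (X := Set α) (Y := Set α))
  have h2 := (isClopen_mem_powerset a).preimage (continuous_snd (X := Set α) (Y := Set α))
  convert (h1.diff h2).union (h2.diff h1) using 1
  ext p
  simp [mem_symmDiff]

/-- Polishable ideals are analytic P-ideals. -/
theorem IsPolishableIdeal.isAnalyticIdeal_and_isPIdeal {I : Order.Ideal (Set ℕ)}
    (h : IsPolishableIdeal I) : IsAnalyticIdeal I ∧ IsPIdeal I := by
  obtain ⟨τ, hP, hadd, hborel⟩ := h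
  let := powersetTopology ℕ
  let := τ
  let := idealAddCommGroup I
  let := powersetAddCommGroup ℕ
  have : T2Space (Set ℕ) := powerset_t2Space ℕ
  have : SecondCountableTopology (Set ℕ) := powerset_secondCountable ℕ
  have : BaireSpace (Set ℕ) := powerset_baireSpace ℕ
  have : IsTopologicalAddGroup (Set ℕ) :=
    { continuous_add := continuous_symmDiff_powerset ℕ
      continuous_neg := continuous_id }
  have : IsTopologicalAddGroup {x : Set ℕ // x ∈ I} :=
    { continuous_add := hadd
      continuous_neg := continuous_id }
  let : MeasurableSpace (Set ℕ) := borel _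
  have : BorelSpace (Set ℕ) := ⟨rfl⟩
  let : MeasurableSpace {x : Set ℕ // x ∈ I} := borel _
  have : BorelSpace {x : Set ℕ // x ∈ I} := ⟨rfl⟩
  let v : {x : Set ℕ // x ∈ I} →+ Set ℕ := ⟨⟨Subtype.val, rfl⟩, fun _ _ => rfl⟩
  have hv : Measurable v := by
    refine measurable_of_isOpen fun U hU => ?_
    change @MeasurableSet _ (@borel _ τ) _
    rw [hborel]
    exact MeasurableSpace.measurableSet_generateFrom ⟨U, hU, rfl⟩
  have hvc : Continuous v :=
    continuous_of_continuousAt_zero v (v.continuous_of_measurable_of_baireSpace hv)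
  refine ⟨?_, fun x hx => ?_⟩
  · have := analyticSet_range_of_polishSpace hvc
    rwa [show range v = (I : Set (Set ℕ)) from Subtype.range_val] at this
  let r : ∀ n, Set ℕ →+ {x : Set ℕ // x ∈ I} := fun n =>
    ⟨⟨fun y => ⟨y ∩ x n, ideal_subset_mem I inter_subset_right (hx n)⟩,
      Subtype.ext (empty_inter _)⟩, fun y z => Subtype.ext (inter_symmDiff_distrib_right y z (x n))⟩
  have hr : ∀ n, Measurable (r n) := fun n => by
    have hc : @Continuous _ _ _ (inheritedTopology I) (r n) :=
      (@continuous_induced_rng _ _ _ _ _ _ _).2 (continuous_to_powerset fun a => by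
        by_cases ha : a ∈ x n
        · simpa [r, ha] using isClopen_mem_powerset a
        · simpa [r, ha] using isClopen_empty)
    have : @Measurable _ _ _ (@borel _ (inheritedTopology I)) (r n) :=
      @Continuous.measurable _ _ _ _ _ (inheritedTopology I) (@borel _ (inheritedTopology I))
        (@BorelSpace.mk _ (inheritedTopology I) (@borel _ (inheritedTopology I)) rfl) _ hc
    rwa [← hborel] at this
  have hrc : ∀ n, ContinuousAt (r n) 0 := fun n =>
    (r n).continuous_of_measurable_of_baireSpace (hr n)
  -- Since `[m, ∞) \ y → ∅`, continuity of `r n` at `0` lets a tail of `x n` be added to `y` with an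
  -- arbitrarily small move in `τ`.
  obtain ⟨u, hu, y, hy⟩ := exists_tendsto_of_forall_nhds
    (fun n (y z : {x : Set ℕ // x ∈ I}) => y.1 ⊆ z.1 ∧ ∃ m, x n ∩ Ici m ⊆ z.1)
    (fun n y U hU => by
      have h0 : Tendsto (fun m : ℕ => Ici m \ y.1) atTop (𝓝 (0 : Set ℕ)) := by
        refine tendsto_powerset.2 fun a => ?_
        filter_upwards [eventually_gt_atTop a] with m hm
        simp only [Set.mem_sdiff, mem_Ici]
        exact iff_of_false (fun h => absurd h.1 (not_le.2 hm)) (notMem_empty a)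
      have h1 : Tendsto (fun m : ℕ => y + r n (Ici m \ y.1)) atTop (𝓝 y) := by
        have := ((hrc n).tendsto.comp h0).const_add y
        rwa [map_zero, add_zero] at this
      obtain ⟨m, hm⟩ := (h1.eventually hU).exists
      have key : (y + r n (Ici m \ y.1)).1 = y.1 ∆ ((Ici m \ y.1) ∩ x n) := rfl
      refine ⟨_, hm, fun k hk => ?_, m, fun k hk => ?_⟩
      · rw [key, mem_symmDiff]
        exact Or.inl ⟨hk, fun h => h.1.2 hk⟩
      · rw [key, mem_symmDiff]
        by_cases hky : k ∈ y.1
        · exact Or.inl ⟨hky, fun h => h.1.2 hky⟩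
        · exact Or.inr ⟨⟨⟨hk.2, hky⟩, hk.1⟩, hky⟩) 0
  have hmono : Monotone fun n => (u n).1 := monotone_nat_of_le_succ fun n => (hu n).1
  have hsub : ∀ n, (u n).1 ⊆ y.1 := fun n k hk => by
    have := tendsto_powerset.1 ((hvc.tendsto y).comp hy) k
    obtain ⟨m, h1, h2⟩ := (this.and (eventually_ge_atTop n)).exists
    exact h1.1 (hmono h2 hk)
  refine ⟨y.1, y.2, fun n => ?_⟩
  obtain ⟨m, hm⟩ := (hu n).2
  refine (finite_Iio m).subset fun k hk => ?_
  by_contra hkm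
  exact hk.2 (hsub (n + 1) (hm ⟨hk.1, mem_Ici.2 (not_lt.1 hkm)⟩))

/-! ### Smallness and Baire category -/

section Smallness

attribute [local instance] powersetTopology

/-- The set of elements of `B` that belong to `y`, for `y` a subset of the subtype `A`. -/
def restrictSubtype {A B : Set ℕ} (h : B ⊆ A) (y : Set A) : Set B := {k | ⟨k.1, h k.2⟩ ∈ y}

/-- Extends a subset of `B` to a subset of `A` by a prescribed set outside `B`. -/
def extendSubtype {A : Set ℕ} (B : Set ℕ) (c : Set A) (y : Set B) : Set A :=
  {k | (∃ h : k.1 ∈ B, ⟨k.1, h⟩ ∈ y) ∨ (k.1 ∉ B ∧ k ∈ c)}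

theorem restrictSubtype_extendSubtype {A B : Set ℕ} (h : B ⊆ A) (c : Set A) (y : Set B) :
    restrictSubtype h (extendSubtype B c y) = y := by
  ext k
  simp [restrictSubtype, extendSubtype]

theorem extendSubtype_restrictSubtype {A B : Set ℕ} (h : B ⊆ A) {c y : Set A}
    (hc : ∀ k : A, k.1 ∉ B → (k ∈ c ↔ k ∈ y)) :
    extendSubtype B c (restrictSubtype h y) = y := by
  ext k
  by_cases hk : k.1 ∈ B
  · simp [restrictSubtype, extendSubtype, hk]
  · simp [extendSubtype, hk, hc k hk]

theorem continuous_restrictSubtype {A B : Set ℕ} (h : B ⊆ A) :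
    Continuous (restrictSubtype h) :=
  continuous_to_powerset fun k => isClopen_mem_powerset (⟨k.1, h k.2⟩ : A)

theorem continuous_extendSubtype {A : Set ℕ} (B : Set ℕ) (c : Set A) :
    Continuous (extendSubtype B c) := by
  refine continuous_to_powerset fun k => ?_
  by_cases hk : k.1 ∈ B
  · simpa [extendSubtype, hk] using isClopen_mem_powerset (⟨k.1, hk⟩ : B)
  · by_cases hc : k ∈ c
    · simpa [extendSubtype, hk, hc] using isClopen_univ
    · simpa [extendSubtype, hk, hc] using isClopen_empty

theorem isOpenMap_restrictSubtype {A B : Set ℕ} (h : B ⊆ A) : IsOpenMap (restrictSubtype h) :=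
  IsOpenMap.of_sections fun x => ⟨extendSubtype B x, (continuous_extendSubtype B x).continuousAt,
    extendSubtype_restrictSubtype h fun _ _ => Iff.rfl, restrictSubtype_extendSubtype h x⟩

theorem isOpenMap_extendSubtype {A B : Set ℕ} (h : B ⊆ A) (hfin : (A \ B).Finite) (c : Set A) :
    IsOpenMap (extendSubtype B c) := by
  intro U hU
  have : extendSubtype B c '' U = restrictSubtype h ⁻¹' U ∩
      ⋂ k ∈ {k : A | k.1 ∉ B}, {y : Set A | k ∈ c ↔ k ∈ y} := by
    ext y
    simp only [mem_inter_iff, mem_iInter, mem_image, mem_preimage]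
    constructor
    · rintro ⟨z, hz, rfl⟩
      refine ⟨by rwa [restrictSubtype_extendSubtype], fun k hk => ?_⟩
      have hk' : k.1 ∉ B := hk
      simp [extendSubtype, hk']
    · exact fun hy => ⟨_, hy.1, extendSubtype_restrictSubtype h hy.2⟩
  rw [this]
  refine (hU.preimage (continuous_restrictSubtype h)).inter (Finite.isOpen_biInter ?_ fun k _ => ?_)
  · refine Finite.of_finite_image (f := Subtype.val) (hfin.subset ?_) Subtype.val_injective.injOn
    rintro _ ⟨k, hk, rfl⟩
    exact ⟨k.2, hk⟩
  · by_cases hc : k ∈ c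
    · simpa [hc] using (isClopen_mem_powerset k).isOpen
    · simp only [hc, false_iff]
      exact (isClopen_mem_powerset k).compl.isOpen

/-- Meagerness of the restriction to `A` implies that of the restriction to larger sets. -/
theorem isMeagre_restrictFamily_of_subset {X : Set (Set ℕ)} {A B : Set ℕ} (h : B ⊆ A)
    (hX : IsMeagre (restrictFamily X B)) : IsMeagre (restrictFamily X A) := by
  refine (hX.preimage_of_isOpenMap (continuous_restrictSubtype h)
    (isOpenMap_restrictSubtype h)).mono ?_
  rintro _ ⟨x, hx, rfl⟩
  exact ⟨x, hx, rfl⟩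

/-- Removing finitely many points from `A` preserves meagerness of the restriction to `A`. -/
theorem isMeagre_restrictFamily_of_finite {X : Set (Set ℕ)} {A B : Set ℕ} (h : B ⊆ A)
    (hfin : (A \ B).Finite) (hX : IsMeagre (restrictFamily X A)) :
    IsMeagre (restrictFamily X B) := by
  -- Only countably many traces on `A \ B` occur, and for each trace `c` the embedding of `P(B)` is
  -- open.
  have hcount : (𝒫 (Subtype.val ⁻¹' (A \ B) : Set A)).Countable :=
    (hfin.preimage Subtype.val_injective.injOn).finite_subsets.countable
  have := hcount.to_subtype
  have hm : IsMeagre (⋃ c : 𝒫 (Subtype.val ⁻¹' (A \ B) : Set A),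
      extendSubtype B c.1 ⁻¹' restrictFamily X A) :=
    isMeagre_iUnion fun c => hX.preimage_of_isOpenMap (continuous_extendSubtype B c.1)
      (isOpenMap_extendSubtype h hfin c.1)
  refine hm.mono ?_
  rintro _ ⟨x, hx, rfl⟩
  refine mem_iUnion.2 ⟨⟨Subtype.val ⁻¹' (x ∩ (A \ B)), fun k hk => hk.2⟩, x, hx, ?_⟩
  change _ = extendSubtype B _ (restrictSubtype h (Subtype.val ⁻¹' x))
  rw [extendSubtype_restrictSubtype h]
  intro k hk
  simp [hk]

/-- For P-ideals, countable unions of small sets are small. -/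
theorem IsPIdeal.isSmallFor_iUnion {I : Order.Ideal (Set ℕ)} (hP : IsPIdeal I)
    (X : ℕ → Set (Set ℕ)) (hX : ∀ n, IsSmallFor I (X n)) : IsSmallFor I (⋃ n, X n) := by
  choose A hA hm using hX
  obtain ⟨B, hB, hfin⟩ := hP A hA
  refine ⟨B, hB, ?_⟩
  rw [restrictFamily, image_iUnion]
  refine isMeagre_iUnion fun n => isMeagre_restrictFamily_of_subset inter_subset_right
    (isMeagre_restrictFamily_of_finite (B := A n ∩ B) inter_subset_left ?_ (hm n))
  rw [sdiff_self_inter]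
  exact hfin n

/-- Ideals for which countable unions of small sets are small are not Rudin-Blass above `I₁`. -/
theorem not_rudinBlassLE_of_isSmallFor_iUnion {I : Order.Ideal (Set ℕ)}
    (h : ∀ X : ℕ → Set (Set ℕ), (∀ n, IsSmallFor I (X n)) → IsSmallFor I (⋃ n, X n)) :
    ¬ RudinBlassLE idealOne I := by
  rintro ⟨b, hb, hbI⟩
  -- For `i = pair n l₀`, these are the sets containing no fibre over `(n, l)` with `l ≥ l₀`. On the
  -- preimage of column `n` this is closed, as fibres are finite, and nowhere dense, as distinct
  -- fibres are disjoint and `z` with a far fibre added tends to `z`.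
  let X : ℕ → Set (Set ℕ) := fun i =>
    {x | ∀ l, (Nat.unpair i).2 ≤ l → ¬ b ⁻¹' {((Nat.unpair i).1, l)} ⊆ x}
  have hX : ∀ i, IsSmallFor I (X i) := by
    intro i
    set n := (Nat.unpair i).1
    set l₀ := (Nat.unpair i).2
    have hcol : {p : ℕ × ℕ | p.1 = n} ∈ idealOne :=
      (finite_singleton n).subset fun k ⟨l, hl⟩ => hl
    refine ⟨_, (hbI _).1 hcol, ?_⟩
    set A := b ⁻¹' {p : ℕ × ℕ | p.1 = n}
    let Z : Set (Set A) := {z | ∀ l, l₀ ≤ l → ¬ (Subtype.val ⁻¹' (b ⁻¹' {(n, l)}) : Set A) ⊆ z}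
    have hsub : restrictFamily (X i) A ⊆ Z := by
      rintro _ ⟨x, hx, rfl⟩ l hl hlx
      refine hx l hl fun j hj => ?_
      have hjA : j ∈ A := by
        have : b j = (n, l) := hj
        change (b j).1 = n
        rw [this]
      exact hlx (show (⟨j, hjA⟩ : A) ∈ (Subtype.val ⁻¹' (b ⁻¹' {(n, l)}) : Set A) from hj)
    have hfin : ∀ l, (Subtype.val ⁻¹' (b ⁻¹' {(n, l)}) : Set A).Finite := fun l =>
      (hb (n, l)).preimage Subtype.val_injective.injOn
    have hZc : IsClosed Z := by
      have : Z = ⋂ l, ⋂ (_ : l₀ ≤ l), (⋂ k ∈ (Subtype.val ⁻¹' (b ⁻¹' {(n, l)}) : Set A),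
          {z : Set A | k ∈ z})ᶜ := by
        ext z
        simp only [Z, mem_iInter, mem_compl_iff, mem_ofPred_eq, subset_def]
      rw [this]
      refine isClosed_iInter fun l => isClosed_iInter fun _ => isClosed_compl_iff.2 ?_
      exact (hfin l).isOpen_biInter fun k _ => (isClopen_mem_powerset k).isOpen
    have hZi : interior Z = ∅ := by
      refine eq_empty_iff_forall_notMem.2 fun z hz => ?_
      have ht : Tendsto (fun l => z ∪ (Subtype.val ⁻¹' (b ⁻¹' {(n, l)}) : Set A)) atTop (𝓝 z) := by
        refine tendsto_powerset.2 fun k => ?_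
        filter_upwards [eventually_gt_atTop (b k.1).2] with l hl
        refine ⟨?_, Or.inl⟩
        rintro (hk | hk)
        · exact hk
        · have : b k.1 = (n, l) := hk
          rw [this] at hl
          exact absurd hl (lt_irrefl _)
      obtain ⟨l, h1, h2⟩ := ((ht.eventually (mem_interior_iff_mem_nhds.1 hz)).and
        (eventually_ge_atTop l₀)).exists
      exact h1 l h2 subset_union_right
    refine IsMeagre.mono hsub ?_
    exact (hZc.isNowhereDense_iff.2 hZi).isMeagre
  obtain ⟨A, hA, hm⟩ := h X hX
  have hx : {p : ℕ × ℕ | b ⁻¹' {p} ⊆ A} ∈ idealOne :=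
    (hbI _).2 (ideal_subset_mem I (fun j hj => hj rfl) hA)
  -- Over column `k` no fibre is contained in `A`, so every subset of `A` belongs to `X (pair k 0)`,
  -- and the restriction to `A` is all of `P(A)`.
  obtain ⟨k, hk⟩ := (show Set.Finite _ from hx).exists_notMem
  have huniv : restrictFamily (⋃ i, X i) A = univ := by
    refine eq_univ_of_forall fun z => ⟨Subtype.val '' z, mem_iUnion.2 ⟨Nat.pair k 0, ?_⟩,
      preimage_image_eq _ Subtype.val_injective⟩
    intro l _ hl
    rw [Nat.unpair_pair] at hl
    refine hk ⟨l, hl.trans ?_⟩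
    rintro _ ⟨a, _, rfl⟩
    exact a.2
  rw [huniv] at hm
  have := powerset_baireSpace A
  exact not_isMeagre_of_isOpen isOpen_univ ⟨∅, trivial⟩ hm

end Smallness

/-! ### The equivalence and the `Π⁰₃` bound -/

theorem mainTheorem5 (I : Order.Ideal (Set ℕ)) (hI : ∀ n : ℕ, {n} ∈ I) :
    List.TFAE [
      ∃ φ : LscSubmeasure, I = φ.exh,
      IsPolishableIdeal I,
      IsAnalyticIdeal I ∧ IsPIdeal I,
      IsAnalyticIdeal I ∧ ¬ RudinBlassLE idealOne I,
      IsAnalyticIdeal I ∧ ∀ X : ℕ → Set (Set ℕ),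
        (∀ n, IsSmallFor I (X n)) → IsSmallFor I (⋃ n, X n)] ∧
    (IsAnalyticIdeal I → IsPIdeal I → IsPiZeroThree (I : Set (Set ℕ))) := by
  have h35 : IsPIdeal I → ∀ X : ℕ → Set (Set ℕ),
      (∀ n, IsSmallFor I (X n)) → IsSmallFor I (⋃ n, X n) := fun h => h.isSmallFor_iUnion
  refine ⟨?_, fun han hP => ?_⟩
  · tfae_have 1 → 2 := by
      rintro ⟨φ, rfl⟩
      exact φ.isPolishableIdeal_exh
    tfae_have 2 → 3 := fun h => h.isAnalyticIdeal_and_isPIdeal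
    tfae_have 3 → 5 := fun h => ⟨h.1, h35 h.2⟩
    tfae_have 5 → 4 := fun h => ⟨h.1, not_rudinBlassLE_of_isSmallFor_iUnion h.2⟩
    tfae_have 4 → 1 := fun h => exists_eq_exh_of_not_rudinBlassLE I hI h.1 h.2
    tfae_finish
  · obtain ⟨φ, rfl⟩ := exists_eq_exh_of_not_rudinBlassLE I hI han
      (not_rudinBlassLE_of_isSmallFor_iUnion (h35 hP))
    exact φ.isPiZeroThree_exh
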